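/- **Setting.** Let $n,k\ge 0$ and $L\ge 0$ be integers. Let $\nu$ be a probability measure on a measurable space $P$ (the law of one feature parameter) and let $\varphi:\mathbb R^n\times P\to\mathbb R^k$ satisfy $\varphi(x,\cdot)\in L^2(\nu)$ for every $x\in\mathbb R^n$ (the feature mapping; a deterministic $\varphi$ is the case where $\nu$ is a point mass). Let the activation $a:\mathbb R\to\mathbb R$ be continuous with $\mathbf E[a(Z)^2]<\infty$ for every centred Gaussian variable $Z$. All weights $w$ and biases $b$ are i.i.d. $\mathcal N(0,1)$ and independent of the feature parameters $\omega_1,\omega_2,\dots$, which are i.i.d. with law $\nu$. For widths $d^1,\dots,d^L$, where $d^1$ is the number of sampled features and, for $l\ge 2$, $d^l$ is the number of neurons of layer $l-1$ that enter layer $l$, the pre-activations are $$f^0_i(x)=b^0_i+\sum_{c=1}^{n}w^0_{ic}x_c,\qquad f^1_i(x)=b^1_i+\frac1{\sqrt{d^1}}\sum_{j=1}^{d^1}\langle w^1_{ij},\varphi(x,\omega_j)\rangle\quad(w^1_{ij}\in\mathbb R^k),$$ $$f^l_i(x)=b^l_i+\frac1{\sqrt{d^l}}\sum_{j=1}^{d^l}w^l_{ij}\,a\big(f^{l-1}_j(x)\big),\qquad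 2\le l\le L.$$ The conjugate kernel of layer $l$ at these widths is $K^0(x,x')=\langle x,x'\rangle+1$, $K^1(x,x')=\frac1{d^1}\sum_{j\le d^1}\varphi(x,\omega_j)^T\varphi(x',\omega_j)+1$ and $K^l(x,x')=\frac1{d^l}\sum_{j\le d^l}a(f^{l-1}_j(x))\,a(f^{l-1}_j(x'))+1$ for $2\le l\le L$. **Theorem 3.1 (Propagation of the Conjugate Kernel).** There are functions $\Sigma^l:\mathbb R^n\times\mathbb R^n\to\mathbb R$ with $$\begin{aligned}\Sigma^0(x,x')&=\langle x,x'\rangle+1,\\ \Sigma^1(x,x')&=\mathbf E_{\omega\sim\nu}\big[\varphi(x,\omega)^T\varphi(x',\omega)\big]+1,\\ \Sigma^l(x,x')&=\mathbf E\big[a(X)\,a(X')\big]+1,\qquad 2\le l\le L,\end{aligned}$$ where $$\begin{pmatrix}X\\X'\end{pmatrix}\sim\mathcal N\left(0,\begin{pmatrix}\Sigma^{l-1}(x,x)&\Sigma^{l-1}(x',x)\\ \Sigma^{l-1}(x,x')&\Sigma^{l-1}(x',x')\end{pmatrix}\right)$$ and all these expectations are of integrable variables, such that the following holds along every sequence of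 widths for which $d^1,\dots,d^L$ all tend to infinity (jointly, at arbitrary relative rates). For every $0\le l\le L$: 1. the random functions $(i,x)\mapsto f^l_i(x)$ converge in the sense of finite-dimensional distributions to a centred Gaussian process on $\mathbb N\times\mathbb R^n$ with covariance $\big((i,x),(i',x')\big)\mapsto\mathbf 1_{i=i'}\,\Sigma^l(x,x')$. That is, the neurons of layer $l$ become independent Gaussian processes $\mathcal{GP}(0,\Sigma^l)$, and these processes exist; 2. the conjugate kernel satisfies $K^l(x,x')\to\Sigma^l(x,x')$ in probability for all $x,x'\in\mathbb R^n$. -/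

import Mathlib

open MeasureTheory ProbabilityTheory Filter

namespace WideMLP

/-- Labels of the scalar Gaussian parameters of the network. Infinitely many neurons are provided
per layer; a network of given widths reads only those it needs. -/
inductive ParamIdx (n k : ℕ) : Type
  | inputWeight (i : ℕ) (c : Fin n)
  | featureWeight (i j : ℕ) (c : Fin k)
  | weight (l i j : ℕ)
  | bias (l i : ℕ)

/-- All parameters: the weights and biases, and the parameters of the features
(frequencies, centres, ...), one for every sampled feature. -/
abbrev Params (n k : ℕ) (P : Type*) : Type _ := (ParamIdx n k → ℝ) × (ℕ → P)

/-- The law of the parameters at initialisation: all weights and biases are i.i.d. standard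
Gaussian, and independent of the feature parameters, which are i.i.d. with law `ν`. -/
noncomputable def initLaw (n k : ℕ) {P : Type*} [MeasurableSpace P] (ν : Measure P)
    [IsProbabilityMeasure ν] : Measure (Params n k P) :=
  (Measure.infinitePi fun _ : ParamIdx n k => gaussianReal 0 1).prod
    (Measure.infinitePi fun _ : ℕ => ν)

instance isProbabilityMeasure_initLaw (n k : ℕ) {P : Type*} [MeasurableSpace P] (ν : Measure P)
    [IsProbabilityMeasure ν] : IsProbabilityMeasure (initLaw n k ν) := by
  unfold initLaw
  infer_instance

variable {n k : ℕ} {P : Type*}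

/-- `preact φ a d θ l i x` is the pre-activation `f_i^l(x; θ)` of neuron `i` in layer `l`.
* Layer `0` is the affine image of the raw input (no feature mapping, no normalisation).
* Layer `1` is the feature mapping layer: it reads the `d 1` sampled features
  `φ(x, ω_j) ∈ ℝ^k`, where `ω_j` is the `j`-th feature parameter (`k = 1`: scalar features).
* Layer `l ≥ 2` reads the `d l` outputs `a (f_j^{l-1}(x; θ))` of the previous layer. -/
noncomputable def preact
    (φ : EuclideanSpace ℝ (Fin n) → P → EuclideanSpace ℝ (Fin k)) (a : ℝ → ℝ) (d : ℕ → ℕ)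
    (θ : Params n k P) : ℕ → ℕ → EuclideanSpace ℝ (Fin n) → ℝ
  | 0, i, x => θ.1 (.bias 0 i) + ∑ c : Fin n, θ.1 (.inputWeight i c) * x c
  | 1, i, x => θ.1 (.bias 1 i) + 1 / √(d 1 : ℝ) *
      ∑ j ∈ Finset.range (d 1), ∑ c : Fin k, θ.1 (.featureWeight i j c) * φ x (θ.2 j) c
  | l + 2, i, x => θ.1 (.bias (l + 2) i) + 1 / √(d (l + 2) : ℝ) *
      ∑ j ∈ Finset.range (d (l + 2)), θ.1 (.weight (l + 2) i j) * a (preact φ a d θ (l + 1) j x)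

/-- The conjugate kernel of layer `l` of a network of finite widths: the normalised Gram matrix of
the vectors which enter layer `l`, plus the contribution `1` of the bias. -/
noncomputable def empiricalCK
    (φ : EuclideanSpace ℝ (Fin n) → P → EuclideanSpace ℝ (Fin k)) (a : ℝ → ℝ) (d : ℕ → ℕ)
    (θ : Params n k P) : ℕ → EuclideanSpace ℝ (Fin n) → EuclideanSpace ℝ (Fin n) → ℝ
  | 0, x, x' => inner ℝ x x' + 1
  | 1, x, x' => (1 / (d 1 : ℝ) *
      ∑ j ∈ Finset.range (d 1), inner ℝ (φ x (θ.2 j)) (φ x' (θ.2 j))) + 1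
  | l + 2, x, x' => (1 / (d (l + 2) : ℝ) *
      ∑ j ∈ Finset.range (d (l + 2)),
        a (preact φ a d θ (l + 1) j x) * a (preact φ a d θ (l + 1) j x')) + 1

/-- The centred Gaussian law on `ℝ²` with covariance matrix
`[[K(x,x), K(x',x)], [K(x,x'), K(x',x')]]`. -/
noncomputable def pairGaussian {T : Type*} (K : T → T → ℝ) (x x' : T) :
    Measure (EuclideanSpace ℝ (Fin 2)) :=
  multivariateGaussian 0 !![K x x, K x' x; K x x', K x' x']

/-- `Q` is the law, on the space of all real functions on `T`, of a Gaussian process with mean `0`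
and covariance function `K`, i.e. `Q = GP(0, K)`. -/
structure IsCentredGP {T : Type*} (Q : Measure (T → ℝ)) (K : T → T → ℝ) : Prop where
  isGaussianProcess : IsGaussianProcess (fun (s : T) (g : T → ℝ) => g s) Q
  mean_eq_zero : ∀ s, ∫ g, g s ∂Q = 0
  covariance_eq : ∀ s s', cov[fun g : T → ℝ => g s, fun g : T → ℝ => g s'; Q] = K s s'

/-- The random functions `X t : T → ℝ` converge, in the sense of finite-dimensional distributions,
to a Gaussian process with mean `0` and covariance `K` as `t → ∞`; the existence of the limiting
process is part of the assertion. -/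
def TendstoGP {Ω T : Type*} [MeasurableSpace Ω] (μ : Measure Ω) [IsProbabilityMeasure μ]
    (X : ℕ → T → Ω → ℝ) (K : T → T → ℝ) : Prop :=
  ∃ (Q : Measure (T → ℝ)) (_ : IsProbabilityMeasure Q), IsCentredGP Q K ∧
    ∀ I : Finset T, TendstoInDistribution
      (fun (t : ℕ) (ω : Ω) (s : I) => X t s ω) atTop
      (fun (g : T → ℝ) (s : I) => g s) (fun _ => μ) Q

end WideMLP

/-!
The pre-activations of a layer are linear in the Gaussian parameters of that layer, and these are
independent of everything the layer reads from below. Conditionally on the lower layers, the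
pre-activations of layer `l` are therefore exactly centred Gaussian, with distinct neurons
independent and with covariance the conjugate kernel `K^l` of the layer. This holds at finite widths
(`exists_layer_representation`, `charFun_map_preact`): the joint characteristic function of
finitely many pre-activations is the expectation of `exp (-q / 2)`, with `q` a quadratic form built
from `K^l`. Both parts of the theorem follow from this by an alternating induction on the layer.

* If `K^l` converges in probability to a constant kernel `Σ^l`, these characteristic functions
  converge to those of independent Gaussian processes with covariance `Σ^l`, and Lévy's continuity
  theorem gives convergence of the finite-dimensional distributions
  (`tendstoInDistribution_preact`).
* `K^(l+1)` is `1` plus an average over the neurons of layer `l`. These are exchangeable, and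
  asymptotically independent by the first point, so that averages of bounded continuous functions
  of them satisfy a weak law of large numbers, by computing second moments
  (`tendstoInMeasure_average_bounded`). The activation `a` is not bounded and only square
  integrable for each Gaussian law, so that the products of activations are truncated. On the event
  `K^l(x, x) ≤ V`, whose probability tends to `1` if `V` is large, the conditional law of a neuron
  is `N(0, v)` with `1 ≤ v ≤ V` (the bias contributes `1`), and is hence bounded by `√V` times
  `N(0, V)`. For this single law `a` is square integrable, which makes the truncation error
  uniformly small (`lintegral_preact_le`, `tendstoInMeasure_average_activation`).

The induction starts at layer `0`, where the kernel is deterministic, and at layer `1`, where it is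
`1` plus an average of i.i.d. variables and the strong law of large numbers applies.

The limiting Gaussian processes exist since each `Σ^l` is `1` plus the Gram kernel of vectors of a
Hilbert space: `ℝ^n` for `l = 0`, `L²(ν)` for `l = 1`, and for `l ≥ 2` the space `L²` of the law of
the limit of layer `l - 1`. An isonormal process on that space, built from independent standard
Gaussians, provides the process (`exists_isCentredGP_neurons`,
`exists_isCentredGP_limitKernel`).
-/

namespace WideMLP

open scoped Topology

/-! ### Isonormal Gaussian processes -/

section IsonormalProcess

/-- A linear combination of finitely many independent standard Gaussians is Gaussian. -/
theorem map_pi_gaussianReal_sum_mul {ι : Type*} [Fintype ι] (y : ι → ℝ) :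
    (Measure.pi fun _ : ι => gaussianReal 0 1).map (fun u => ∑ i, u i * y i) =
      gaussianReal 0 (∑ i, y i ^ 2).toNNReal := by
  apply Measure.ext_of_charFun
  ext t
  have h0 : 0 ≤ ∑ i, y i ^ 2 := Finset.sum_nonneg fun i _ => sq_nonneg _
  have h := charFun_stdGaussian (WithLp.toLp 2 (t • y) : EuclideanSpace ℝ ι)
  rw [← map_pi_eq_stdGaussian, charFun_apply, integral_map (by fun_prop) (by fun_prop)] at h
  have hm : Measurable fun u : ι → ℝ => ∑ i, u i * y i := by fun_prop
  rw [charFun_apply, integral_map hm.aemeasurable (by fun_prop), charFun_gaussianReal]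
  convert h using 2
  · ext u
    simp [PiLp.inner_apply, Finset.mul_sum]
    congr! 2
    norm_cast
    refine Finset.sum_congr rfl fun i _ => ?_
    ring
  · rw [← Complex.ofReal_pow ‖_‖, EuclideanSpace.real_norm_sq_eq]
    simp [Real.coe_toNNReal _ h0, mul_pow, ← Finset.mul_sum]
    ring

section Isonormal

variable {ι : Type*}

theorem map_infinitePi_gaussianReal_sum_mul (F : Finset ι) (c : ι → ℝ) :
    (Measure.infinitePi fun _ : ι => gaussianReal 0 1).map (fun g => ∑ i ∈ F, c i * g i) =
      gaussianReal 0 (∑ i ∈ F, c i ^ 2).toNNReal := by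
  have h := map_pi_gaussianReal_sum_mul (fun i : F => c i)
  rw [← Measure.infinitePi_map_restrict (μ := fun _ : ι => gaussianReal 0 1) (I := F),
    Measure.map_map (by fun_prop) (by fun_prop)] at h
  rw [← Finset.sum_coe_sort F fun i => c i ^ 2, ← h]
  congr 1
  ext g
  simp only [Function.comp, Finset.restrict]
  rw [← Finset.sum_coe_sort F]
  exact Finset.sum_congr rfl fun i _ => mul_comm _ _

theorem memLp_eval_infinitePi_gaussianReal (i : ι) :
    MemLp (fun g : ι → ℝ => g i) 2 (Measure.infinitePi fun _ : ι => gaussianReal 0 1) :=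
  (memLp_id_gaussianReal 2).comp_measurePreserving
    (measurePreserving_eval_infinitePi (fun _ : ι => gaussianReal 0 1) i)

/-- The `i`-th coordinate of a family of independent standard Gaussians, as an element of `L²`. -/
noncomputable def gaussianCoord (i : ι) :
    Lp ℝ 2 (Measure.infinitePi fun _ : ι => gaussianReal 0 1) :=
  (memLp_eval_infinitePi_gaussianReal i).toLp _

theorem coeFn_sum_smul_gaussianCoord (F : Finset ι) (c : ι → ℝ) :
    (∑ i ∈ F, c i • gaussianCoord i : Lp ℝ 2 _) =ᵐ[Measure.infinitePi fun _ : ι => gaussianReal 0 1]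
      fun g => ∑ i ∈ F, c i * g i := by
  have h1 : ∀ᵐ g ∂(Measure.infinitePi fun _ : ι => gaussianReal 0 1),
      ∀ i ∈ F, (c i • gaussianCoord i : Lp ℝ 2 _) g = c i * g i := by
    rw [Filter.eventually_all_finset]
    intro i hi
    filter_upwards [Lp.coeFn_smul (c i) (gaussianCoord i),
      (memLp_eval_infinitePi_gaussianReal i).coeFn_toLp] with g h h'
    rw [h, Pi.smul_apply, gaussianCoord, h', smul_eq_mul]
  filter_upwards [h1, Lp.coeFn_finsetSum F fun i => c i • gaussianCoord i] with g h h'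
  rw [h']
  simp only [Finset.sum_apply]
  exact Finset.sum_congr rfl fun i hi => h i hi

theorem orthonormal_gaussianCoord : Orthonormal ℝ (gaussianCoord (ι := ι)) := by
  classical
  rw [orthonormal_iff_ite]
  intro i j
  rw [L2.inner_def]
  have h : ∀ᵐ g ∂(Measure.infinitePi fun _ : ι => gaussianReal 0 1),
      inner ℝ ((gaussianCoord i : Lp ℝ 2 _) g) ((gaussianCoord j : Lp ℝ 2 _) g) = g i * g j := by
    filter_upwards [(memLp_eval_infinitePi_gaussianReal i).coeFn_toLp,
      (memLp_eval_infinitePi_gaussianReal j).coeFn_toLp] with g h h'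
    rw [gaussianCoord, gaussianCoord, h, h']
    simp [mul_comm]
  rw [integral_congr_ae h]
  have hi (i : ι) : ∫ g : ι → ℝ, g i ∂(Measure.infinitePi fun _ : ι => gaussianReal 0 1) = 0 := by
    have := integral_id_gaussianReal (μ := 0) (v := 1)
    rwa [← (measurePreserving_eval_infinitePi (fun _ : ι => gaussianReal 0 1) i).map_eq,
      integral_map (measurable_pi_apply i).aemeasurable (by fun_prop)] at this
  split_ifs with hij
  · subst hij
    have := variance_id_gaussianReal (μ := 0) (v := 1)
    rw [variance_eq_integral (by fun_prop), show ∫ x, id x ∂gaussianReal 0 1 = 0 from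
      integral_id_gaussianReal,
      ← (measurePreserving_eval_infinitePi (fun _ : ι => gaussianReal 0 1) i).map_eq,
      integral_map (measurable_pi_apply i).aemeasurable (by fun_prop)] at this
    simpa [sq] using this
  · have hind := (iIndepFun_infinitePi (P := fun _ : ι => gaussianReal 0 1)
      (X := fun _ x => x) (fun _ => measurable_id)).indepFun hij
    have := hind.integral_mul_eq_mul_integral
      (measurable_pi_apply i).aestronglyMeasurable (measurable_pi_apply j).aestronglyMeasurable
    simp only [Pi.mul_apply] at this
    rw [this, hi, zero_mul]

end Isonormal

/-- On every real Hilbert space there is an isonormal Gaussian process. -/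
theorem exists_isonormal (H : Type*) [NormedAddCommGroup H] [InnerProductSpace ℝ H]
    [CompleteSpace H] : ∃ (w : Set H)
      (W : H →ₗᵢ[ℝ] Lp ℝ 2 (Measure.infinitePi fun _ : w => gaussianReal 0 1)),
      ∀ v, (Measure.infinitePi fun _ : w => gaussianReal 0 1).map (W v) =
        gaussianReal 0 (‖v‖ ^ 2).toNNReal := by
  -- The isometry sends a Hilbert basis of `H` to independent standard Gaussians. The law of a
  -- finite combination of these is known; the law of an infinite one is a limit of such laws.
  obtain ⟨w, b, -⟩ := exists_hilbertBasis ℝ H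
  have hV := (orthonormal_gaussianCoord (ι := w)).orthogonalFamily
  refine ⟨w, hV.linearIsometry.comp b.repr.toLinearIsometry, fun v => ?_⟩
  set μ := Measure.infinitePi fun _ : w => gaussianReal 0 1
  set f := b.repr v
  have hsum := hV.hasSum_linearIsometry f
  simp only [LinearIsometry.toSpanSingleton_apply] at hsum
  have hn : HasSum (fun i => f i ^ 2) (‖v‖ ^ 2) := by
    have := lp.hasSum_norm (p := 2) (by simp) f
    simpa [f, sq_abs] using this
  -- The partial sums form a net over finite sets; a sequence is needed for convergence in measure.
  obtain ⟨F, hF⟩ : ∃ F : ℕ → Finset w,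
      Tendsto (fun n => (∑ i ∈ F n, f i • gaussianCoord i, ∑ i ∈ F n, f i ^ 2)) atTop
        (𝓝 (hV.linearIsometry f, ‖v‖ ^ 2)) := by
    have hcl := mem_closure_of_tendsto (Tendsto.prodMk_nhds hsum hn)
      (Eventually.of_forall fun F => Set.mem_range_self F)
    obtain ⟨x, hx, hlim⟩ := mem_closure_iff_seq_limit.1 hcl
    choose F hF using hx
    exact ⟨F, by simpa [hF] using hlim⟩
  have hd : TendstoInDistribution (fun n g => ∑ i ∈ F n, f i * g i) atTop
      (hV.linearIsometry f) (fun _ => μ) μ := by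
    refine TendstoInMeasure.tendstoInDistribution ?_ ?_
    · refine TendstoInMeasure.congr_left (fun n => coeFn_sum_smul_gaussianCoord (F n) f) ?_
      exact tendstoInMeasure_of_tendsto_Lp ((continuous_fst.tendsto _).comp hF)
    · refine fun n => (Finset.measurable_fun_sum _ fun i _ => ?_).aemeasurable
      exact measurable_const.mul (measurable_pi_apply i)
  apply Measure.ext_of_charFun
  ext t
  have h2 := ProbabilityMeasure.tendsto_iff_tendsto_charFun.1 hd.tendsto t
  refine tendsto_nhds_unique h2 ?_
  simp only [ProbabilityMeasure.coe_mk, μ, map_infinitePi_gaussianReal_sum_mul,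
    charFun_gaussianReal]
  have h4 : Continuous fun r : ℝ =>
      Complex.exp (t * ((0 : ℝ) : ℂ) * Complex.I - (r.toNNReal : ℝ) * t ^ 2 / 2) := by
    fun_prop
  exact (h4.tendsto _).comp ((continuous_snd.tendsto _).comp hF)

end IsonormalProcess

/-! ### Centred Gaussian processes -/

section ProcessLaws

/-- An isonormal process, evaluated along a family of vectors, is a centred Gaussian process whose
covariance is the Gram kernel of the family. -/
theorem isCentredGP_map_isonormal {Ω T H : Type*} [MeasurableSpace Ω] {μ : Measure Ω}
    [IsProbabilityMeasure μ] [NormedAddCommGroup H] [InnerProductSpace ℝ H]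
    (W : H →ₗᵢ[ℝ] Lp ℝ 2 μ) (hW : ∀ v, μ.map (W v) = gaussianReal 0 (‖v‖ ^ 2).toNNReal)
    (v : T → H) :
    IsCentredGP (μ.map fun g s => W (v s) g) fun s s' => inner ℝ (v s) (v s') := by
  classical
  have hm (u : H) : Measurable (W u) := (Lp.stronglyMeasurable _).measurable
  have hm' : Measurable fun (g : Ω) (s : T) => W (v s) g :=
    measurable_pi_lambda _ fun s => hm _
  have hmean (u : H) : ∫ g, W u g ∂μ = 0 := by
    have := integral_id_gaussianReal (μ := 0) (v := (‖u‖ ^ 2).toNNReal)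
    rwa [← hW u, integral_map (hm u).aemeasurable (by fun_prop)] at this
  have hL2 (u : H) : MemLp (W u) 2 μ := Lp.memLp _
  refine ⟨⟨fun I => ⟨?_⟩⟩, fun s => ?_, fun s s' => ?_⟩
  · rw [Measure.map_map (by fun_prop) hm']
    refine isGaussian_of_map_eq_gaussianReal fun L => ?_
    refine ⟨0, (‖∑ s : I, L (Pi.single s 1) • v s‖ ^ 2).toNNReal, ?_⟩
    rw [← hW, Measure.map_map (by fun_prop) (by fun_prop)]
    refine Measure.map_congr ?_
    have h1 : ∀ᵐ g ∂μ, ∀ s ∈ (Finset.univ : Finset I),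
        (W (L (Pi.single s 1) • v s)) g = L (Pi.single s 1) * W (v s) g := by
      rw [Filter.eventually_all_finset]
      intro s _
      rw [map_smul]
      filter_upwards [Lp.coeFn_smul (L (Pi.single s 1)) (W (v s))] with g h
      rw [h, Pi.smul_apply, smul_eq_mul]
    rw [map_sum]
    filter_upwards [h1, Lp.coeFn_finsetSum Finset.univ fun s : I => W (L (Pi.single s 1) • v s)]
      with g h h'
    rw [h', Finset.sum_apply, Finset.sum_congr rfl h]
    simp only [Function.comp]
    rw [← L.coe_coe, LinearMap.pi_apply_eq_sum_univ]
    refine Finset.sum_congr rfl fun s _ => ?_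
    rw [smul_eq_mul, mul_comm]
    congr 3
    ext i
    simp [Pi.single_apply, eq_comm]
  · rw [integral_map hm'.aemeasurable (measurable_pi_apply s).aestronglyMeasurable]
    exact hmean _
  · rw [covariance_map (measurable_pi_apply s).aestronglyMeasurable
      (measurable_pi_apply s').aestronglyMeasurable hm'.aemeasurable,
      show ((fun f : T → ℝ => f s) ∘ fun g s => W (v s) g) = W (v s) from rfl,
      show ((fun f : T → ℝ => f s') ∘ fun g s => W (v s) g) = W (v s') from rfl,
      covariance_eq_sub (hL2 _) (hL2 _), hmean, zero_mul, sub_zero, ← W.inner_map_map, L2.inner_def]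
    simp [mul_comm]

/-- A kernel which is the Gram kernel of a family of vectors of a Hilbert space is the covariance of
a centred Gaussian process. -/
theorem exists_isCentredGP_inner {T H : Type*} [NormedAddCommGroup H] [InnerProductSpace ℝ H]
    [CompleteSpace H] (v : T → H) :
    ∃ (Q : Measure (T → ℝ)) (_ : IsProbabilityMeasure Q),
      IsCentredGP Q fun s s' => inner ℝ (v s) (v s') := by
  obtain ⟨w, W, hW⟩ := exists_isonormal H
  refine ⟨_, Measure.isProbabilityMeasure_map ?_, isCentredGP_map_isonormal W hW v⟩
  exact (measurable_pi_lambda _ fun s => (Lp.stronglyMeasurable _).measurable).aemeasurable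

/-- Independent copies, indexed by `ℕ`, of the centred Gaussian process with kernel
`⟪v x, v x'⟫ + 1`. -/
theorem exists_isCentredGP_neurons {T H : Type*} [NormedAddCommGroup H] [InnerProductSpace ℝ H]
    [CompleteSpace H] (v : T → H) :
    ∃ (Q : Measure (ℕ × T → ℝ)) (_ : IsProbabilityMeasure Q),
      IsCentredGP Q fun s s' => if s.1 = s'.1 then inner ℝ (v s.2) (v s'.2) + 1 else 0 := by
  -- The copies correspond to the orthogonal summands of the Hilbert sum of copies of `H × ℝ`, where
  -- the vector `(v x, 1)` accounts for the summand `1` of the kernel.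
  obtain ⟨Q, hQ, h⟩ := exists_isCentredGP_inner fun s : ℕ × T =>
    lp.single (E := fun _ : ℕ => WithLp 2 (H × ℝ)) 2 s.1 (WithLp.toLp 2 (v s.2, 1))
  refine ⟨Q, hQ, ?_⟩
  convert h using 3 with s s'
  rw [lp.inner_single_left]
  by_cases hs : s.1 = s'.1
  · simp [hs]
  · simp [hs, lp.single_apply]

section CentredGP

variable {T : Type*} {Q : Measure (T → ℝ)} {K : T → T → ℝ}

theorem IsCentredGP.map_eval (hQ : IsCentredGP Q K) (s : T) :
    Q.map (fun g => g s) = gaussianReal 0 (K s s).toNNReal := by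
  rw [(hQ.isGaussianProcess.hasGaussianLaw_eval s).map_eq_gaussianReal, hQ.mean_eq_zero,
    ← hQ.covariance_eq, covariance_self (measurable_pi_apply s).aemeasurable]

theorem IsCentredGP.memLp_eval (hQ : IsCentredGP Q K) (s : T) : MemLp (fun g : T → ℝ => g s) 2 Q :=
  (hQ.isGaussianProcess.hasGaussianLaw_eval s).memLp_two

variable [IsProbabilityMeasure Q]

theorem IsCentredGP.variance_sum (hQ : IsCentredGP Q K) {κ : Type*} [Fintype κ] (s : κ → T)
    (u : κ → ℝ) :
    Var[fun g => ∑ q, u q * g (s q); Q] = ∑ q, ∑ q', u q * u q' * K (s q) (s q') := by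
  rw [variance_fun_sum fun q => (hQ.memLp_eval (s q)).const_mul (u q)]
  simp only [covariance_const_mul_left, covariance_const_mul_right, hQ.covariance_eq]
  exact Finset.sum_congr rfl fun q _ => Finset.sum_congr rfl fun q' _ => by ring

theorem IsCentredGP.sum_nonneg (hQ : IsCentredGP Q K) {κ : Type*} [Fintype κ] (s : κ → T)
    (u : κ → ℝ) : 0 ≤ ∑ q, ∑ q', u q * u q' * K (s q) (s q') := by
  rw [← hQ.variance_sum]
  exact variance_nonneg _ _

theorem IsCentredGP.map_sum (hQ : IsCentredGP Q K) {κ : Type*} [Fintype κ] (s : κ → T)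
    (u : κ → ℝ) :
    Q.map (fun g => ∑ q, u q * g (s q)) =
      gaussianReal 0 (∑ q, ∑ q', u q * u q' * K (s q) (s q')).toNNReal := by
  have hG : HasGaussianLaw (fun g : T → ℝ => ∑ q, u q * g (s q)) Q :=
    ((hQ.isGaussianProcess.comp_right s).smul u).hasGaussianLaw_fun_sum (I := Finset.univ)
  rw [hG.map_eq_gaussianReal, hQ.variance_sum,
    integral_finsetSum _ fun q _ => ((hQ.memLp_eval (s q)).integrable one_le_two).const_mul (u q)]
  simp [integral_const_mul, hQ.mean_eq_zero]

/-- The characteristic functions of the finite-dimensional laws of a centred Gaussian process. -/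
theorem IsCentredGP.charFun_map (hQ : IsCentredGP Q K) {κ : Type*} [Fintype κ] (s : κ → T)
    (u : EuclideanSpace ℝ κ) :
    charFun (Q.map fun g => (WithLp.toLp 2 fun q => g (s q) : EuclideanSpace ℝ κ)) u =
      Complex.exp (-((∑ q, ∑ q', u q * u q' * K (s q) (s q') : ℝ) : ℂ) / 2) := by
  have hm : Measurable fun g : T → ℝ => (WithLp.toLp 2 fun q => g (s q) : EuclideanSpace ℝ κ) := by
    fun_prop
  have hm' : Measurable fun g : T → ℝ => ∑ q, u q * g (s q) := by fun_prop
  have h1 := charFun_gaussianReal (μ := 0)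
    (v := (∑ q, ∑ q', u q * u q' * K (s q) (s q')).toNNReal) 1
  rw [← hQ.map_sum, charFun_apply, integral_map hm'.aemeasurable (by fun_prop)] at h1
  rw [charFun_apply, integral_map hm.aemeasurable (by fun_prop)]
  convert h1 using 2
  · ext g
    simp [PiLp.inner_apply]
  · rw [Real.coe_toNNReal _ (hQ.sum_nonneg s u)]
    simp [neg_div]

/-- `pairGaussian` is given by a matrix, and is the intended law only if this matrix is positive
semidefinite; for the covariance kernel of a process it is, and the law is that of the process at
two points. -/
theorem IsCentredGP.pairGaussian_eq (hQ : IsCentredGP Q K) (x x' : T) :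
    pairGaussian K x x' =
      Q.map fun g => (WithLp.toLp 2 fun q => g (![x, x'] q) : EuclideanSpace ℝ (Fin 2)) := by
  have hsymm : K x x' = K x' x := by
    rw [← hQ.covariance_eq, ← hQ.covariance_eq, covariance_comm]
  have hS : (!![K x x, K x' x; K x x', K x' x'] : Matrix (Fin 2) (Fin 2) ℝ).PosSemidef := by
    refine Matrix.PosSemidef.of_dotProduct_mulVec_nonneg ?_ fun u => ?_
    · ext i j
      fin_cases i <;> fin_cases j <;> simp [hsymm]
    · have := hQ.sum_nonneg ![x, x'] u
      simp [Fin.sum_univ_two, Matrix.mulVec, dotProduct] at this ⊢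
      rw [hsymm] at this ⊢
      linarith
  have hm : Measurable fun g : T → ℝ =>
      (WithLp.toLp 2 fun q => g (![x, x'] q) : EuclideanSpace ℝ (Fin 2)) := by
    fun_prop
  have := Measure.isProbabilityMeasure_map (μ := Q) hm.aemeasurable
  have : IsProbabilityMeasure (pairGaussian K x x') := by unfold pairGaussian; infer_instance
  apply Measure.ext_of_charFun
  ext u
  rw [hQ.charFun_map, pairGaussian, charFun_multivariateGaussian hS]
  congr 1
  simp [Fin.sum_univ_two, Matrix.mulVec, dotProduct, hsymm]
  ring

end CentredGP

end ProcessLaws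

/-! ### Conditionally Gaussian linear combinations -/

section ParameterIndependence

section ConditionallyGaussian

variable {Ω κ : Type*} [MeasurableSpace Ω] [Fintype κ] {μ : Measure Ω} [IsProbabilityMeasure μ]
  {U Y : Ω → κ → ℝ}

/-- A linear combination of independent standard Gaussians `U`, whose coefficients `Y` are random
but independent of `U`, is, conditionally on `Y`, centred Gaussian with variance `∑ q, Y q ^ 2`. -/
theorem lintegral_sum_mul_of_indepFun (hU : Measurable U) (hY : Measurable Y)
    (hlaw : μ.map U = Measure.pi fun _ => gaussianReal 0 1) (hind : IndepFun U Y μ)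
    {h : (κ → ℝ) → ℝ → ENNReal} (hh : Measurable (Function.uncurry h)) :
    ∫⁻ ω, h (Y ω) (∑ q, U ω q * Y ω q) ∂μ =
      ∫⁻ ω, ∫⁻ z, h (Y ω) z ∂gaussianReal 0 (∑ q, Y ω q ^ 2).toNNReal ∂μ := by
  have hprod := (indepFun_iff_map_prod_eq_prod_map_map hU.aemeasurable hY.aemeasurable).1 hind
  have hm : Measurable fun p : (κ → ℝ) × (κ → ℝ) => h p.2 (∑ q, p.1 q * p.2 q) :=
    hh.comp (f := fun p : (κ → ℝ) × (κ → ℝ) => (p.2, ∑ q, p.1 q * p.2 q)) (by fun_prop)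
  have := Measure.isProbabilityMeasure_map (μ := μ) hU.aemeasurable
  have := Measure.isProbabilityMeasure_map (μ := μ) hY.aemeasurable
  have hin (y : κ → ℝ) : ∫⁻ u, h y (∑ q, u q * y q) ∂(μ.map U) =
      ∫⁻ z, h y z ∂gaussianReal 0 (∑ q, y q ^ 2).toNNReal := by
    rw [hlaw, ← map_pi_gaussianReal_sum_mul, lintegral_map (hh.of_uncurry_left) (by fun_prop)]
  calc ∫⁻ ω, h (Y ω) (∑ q, U ω q * Y ω q) ∂μ
      = ∫⁻ p, h p.2 (∑ q, p.1 q * p.2 q) ∂(μ.map fun ω => (U ω, Y ω)) :=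
        (lintegral_map hm (hU.prodMk hY)).symm
    _ = ∫⁻ y, ∫⁻ u, h y (∑ q, u q * y q) ∂(μ.map U) ∂(μ.map Y) := by
        rw [hprod, lintegral_prod_symm' _ hm]
    _ = ∫⁻ ω, ∫⁻ u, h (Y ω) (∑ q, u q * Y ω q) ∂(μ.map U) ∂μ :=
        lintegral_map hm.lintegral_prod_left' hY
    _ = _ := lintegral_congr fun ω => hin (Y ω)

/-- The same as `lintegral_sum_mul_of_indepFun` for the characteristic function, stated for complex
integrals. -/
theorem integral_cexp_sum_mul_of_indepFun (hU : Measurable U) (hY : Measurable Y)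
    (hlaw : μ.map U = Measure.pi fun _ => gaussianReal 0 1) (hind : IndepFun U Y μ) :
    ∫ ω, Complex.exp ((∑ q, U ω q * Y ω q : ℝ) * Complex.I) ∂μ =
      ∫ ω, Complex.exp (-((∑ q, Y ω q ^ 2 : ℝ) : ℂ) / 2) ∂μ := by
  have hprod := (indepFun_iff_map_prod_eq_prod_map_map hU.aemeasurable hY.aemeasurable).1 hind
  have hm : StronglyMeasurable fun p : (κ → ℝ) × (κ → ℝ) =>
      Complex.exp ((∑ q, p.1 q * p.2 q : ℝ) * Complex.I) :=
    Measurable.stronglyMeasurable (by fun_prop)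
  have := Measure.isProbabilityMeasure_map (μ := μ) hU.aemeasurable
  have := Measure.isProbabilityMeasure_map (μ := μ) hY.aemeasurable
  have hin (y : κ → ℝ) : ∫ u, Complex.exp ((∑ q, u q * y q : ℝ) * Complex.I) ∂(μ.map U) =
      Complex.exp (-((∑ q, y q ^ 2 : ℝ) : ℂ) / 2) := by
    have h0 : 0 ≤ ∑ q, y q ^ 2 := Finset.sum_nonneg fun i _ => sq_nonneg _
    have h1 := charFun_gaussianReal (μ := 0) (v := (∑ q, y q ^ 2).toNNReal) 1
    have hm' : Measurable fun u : κ → ℝ => ∑ q, u q * y q := by fun_prop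
    rw [← map_pi_gaussianReal_sum_mul, charFun_apply,
      integral_map hm'.aemeasurable (by fun_prop)] at h1
    rw [hlaw]
    convert h1 using 2
    · simp
    · rw [Real.coe_toNNReal _ h0]
      simp [neg_div]
  calc ∫ ω, Complex.exp ((∑ q, U ω q * Y ω q : ℝ) * Complex.I) ∂μ
      = ∫ p, Complex.exp ((∑ q, p.1 q * p.2 q : ℝ) * Complex.I) ∂(μ.map fun ω => (U ω, Y ω)) :=
        (integral_map (hU.prodMk hY).aemeasurable hm.aestronglyMeasurable).symm
    _ = ∫ y, ∫ u, Complex.exp ((∑ q, u q * y q : ℝ) * Complex.I) ∂(μ.map U) ∂(μ.map Y) := by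
        rw [hprod, integral_prod_symm]
        refine Integrable.of_bound hm.aestronglyMeasurable 1 (ae_of_all _ fun p => ?_)
        rw [Complex.norm_exp_ofReal_mul_I]
    _ = ∫ y, Complex.exp (-((∑ q, y q ^ 2 : ℝ) : ℂ) / 2) ∂(μ.map Y) :=
        integral_congr_ae (ae_of_all _ hin)
    _ = _ := integral_map hY.aemeasurable
        (Measurable.stronglyMeasurable (by fun_prop)).aestronglyMeasurable

end ConditionallyGaussian

/-- Centred Gaussian laws with variances in `[1, V]` are dominated by a multiple of the law with
variance `V`. The lower bound on the variance keeps the densities bounded. -/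
theorem lintegral_gaussianReal_le {v V : NNReal} (hv : 1 ≤ v) (hV : v ≤ V) (h : ℝ → ENNReal) :
    ∫⁻ z, h z ∂gaussianReal 0 v ≤ ENNReal.ofReal √V * ∫⁻ z, h z ∂gaussianReal 0 V := by
  have hv0 : (0 : ℝ) < v := by exact_mod_cast zero_lt_one.trans_le hv
  have hV0 : (0 : ℝ) < V := hv0.trans_le (by exact_mod_cast hV)
  have hle : gaussianReal 0 v ≤ ENNReal.ofReal √V • gaussianReal 0 V := by
    rw [gaussianReal_of_var_ne_zero _ (by exact_mod_cast hv0.ne'),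
      gaussianReal_of_var_ne_zero _ (by exact_mod_cast hV0.ne'),
      ← withDensity_smul _ (measurable_gaussianPDF 0 V)]
    refine withDensity_mono (ae_of_all _ fun z => ?_)
    simp only [gaussianPDF, Pi.smul_apply, smul_eq_mul]
    rw [← ENNReal.ofReal_mul (by positivity)]
    refine ENNReal.ofReal_le_ofReal ?_
    simp only [gaussianPDFReal, ← mul_assoc, sub_zero]
    have hv1 : (1 : ℝ) ≤ v := by exact_mod_cast hv
    have hvV : (v : ℝ) ≤ V := by exact_mod_cast hV
    have h1 : √(V : ℝ) * (√(2 * Real.pi * V))⁻¹ = (√(2 * Real.pi))⁻¹ := by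
      rw [Real.sqrt_mul (by positivity) (V : ℝ)]
      have : 0 < √(V : ℝ) := Real.sqrt_pos.2 hV0
      field_simp
    rw [h1]
    refine mul_le_mul ?_ ?_ (Real.exp_nonneg _) (by positivity)
    · refine inv_anti₀ (by positivity) (Real.sqrt_le_sqrt ?_)
      nlinarith [Real.pi_pos]
    · refine Real.exp_le_exp.2 ?_
      rw [neg_div, neg_div, neg_le_neg_iff]
      gcongr
  calc ∫⁻ z, h z ∂gaussianReal 0 v
      ≤ ∫⁻ z, h z ∂(ENNReal.ofReal √V • gaussianReal 0 V) := lintegral_mono' hle le_rfl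
    _ = _ := by rw [lintegral_smul_measure, smul_eq_mul]

/-! ### Parameters of the layers and their independence -/

variable {n k : ℕ} {P : Type*}

/-- The layer to which a scalar parameter belongs. -/
def ParamIdx.layer : ParamIdx n k → ℕ
  | .inputWeight _ _ => 0
  | .featureWeight _ _ _ => 1
  | .weight l _ _ => l
  | .bias l _ => l

variable [MeasurableSpace P]

/-- The parameters on which the inputs of layer `l` depend: the scalar parameters of the
layers below `l` and all feature parameters. -/
def lowerParams (l : ℕ) (θ : Params n k P) : ({p : ParamIdx n k // p.layer < l} → ℝ) × (ℕ → P) :=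
  (fun p => θ.1 p, θ.2)

/-- The σ-algebra generated by the parameters on which the inputs of layer `l` depend. -/
abbrev lowerAlgebra (n k : ℕ) (P : Type*) [MeasurableSpace P] (l : ℕ) :
    MeasurableSpace (Params n k P) :=
  MeasurableSpace.comap (lowerParams l) inferInstance

theorem measurable_lowerParams (l : ℕ) :
    Measurable (lowerParams (n := n) (k := k) (P := P) l) := by
  unfold lowerParams
  fun_prop

theorem lowerAlgebra_le (l : ℕ) :
    lowerAlgebra n k P l ≤ (inferInstance : MeasurableSpace (Params n k P)) :=
  (measurable_lowerParams l).comap_le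

theorem measurable_lowerAlgebra_param {l : ℕ} {p : ParamIdx n k} (hp : p.layer < l) :
    Measurable[lowerAlgebra n k P l] fun θ : Params n k P => θ.1 p :=
  Measurable.comp (g := fun r : ({p : ParamIdx n k // p.layer < l} → ℝ) × (ℕ → P) => r.1 ⟨p, hp⟩)
    (by fun_prop) (comap_measurable (lowerParams l))

theorem measurable_lowerAlgebra_feature (l j : ℕ) :
    Measurable[lowerAlgebra n k P l] fun θ : Params n k P => θ.2 j :=
  Measurable.comp (g := fun r : ({p : ParamIdx n k // p.layer < l} → ℝ) × (ℕ → P) => r.2 j)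
    (by fun_prop) (comap_measurable (lowerParams l))

section

variable (ν : Measure P) [IsProbabilityMeasure ν]

theorem map_param_initLaw {κ : Type*} [Fintype κ] {e : κ → ParamIdx n k}
    (he : Function.Injective e) :
    (initLaw n k ν).map (fun θ q => θ.1 (e q)) = Measure.pi fun _ => gaussianReal 0 1 := by
  have h : (fun θ : Params n k P => fun q => θ.1 (e q)) = (fun g q => g (e q)) ∘ Prod.fst := rfl
  rw [h, ← Measure.map_map (by fun_prop) measurable_fst, initLaw, Measure.map_fst_prod]
  simp [Measure.map_infinitePi_infinitePi_of_inj he, Measure.infinitePi_eq_pi]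

/-- The parameters of layer `l` are independent of those on which the inputs of layer `l`
depend. -/
theorem indepFun_lowerParams {κ : Type*} {e : κ → ParamIdx n k} {l : ℕ}
    (he : ∀ q, (e q).layer = l) :
    IndepFun (fun θ : Params n k P => fun q => θ.1 (e q)) (lowerParams l) (initLaw n k ν) := by
  set μ := Measure.infinitePi fun _ : ParamIdx n k => gaussianReal 0 1
  set ρ := Measure.infinitePi fun _ : ℕ => ν
  let A : (ParamIdx n k → ℝ) → κ → ℝ := fun g q => g (e q)
  let B : (ParamIdx n k → ℝ) → {p : ParamIdx n k // p.layer < l} → ℝ := fun g p => g p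
  have hA : Measurable A := by fun_prop
  have hB : Measurable B := by fun_prop
  have hAB : IndepFun A B μ := by
    have hi : iIndep (fun p : ParamIdx n k =>
        MeasurableSpace.comap (fun g : ParamIdx n k → ℝ => g p) inferInstance) μ :=
      iIndepFun_infinitePi (P := fun _ : ParamIdx n k => gaussianReal 0 1)
        (X := fun _ x => x) (fun _ => measurable_id)
    -- Disjoint sets of independent coordinates generate independent σ-algebras.
    have hd : Disjoint (Set.range e) {p | p.layer < l} := by
      rw [Set.disjoint_left]
      rintro _ ⟨q, rfl⟩ hq
      exact (he q ▸ hq : l < l).false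
    have hs := indep_iSup_of_disjoint (fun p => (measurable_pi_apply p).comap_le) hi hd
    refine indep_of_indep_of_le_right (indep_of_indep_of_le_left hs ?_) ?_
    · rw [MeasurableSpace.pi, MeasurableSpace.comap_iSup]
      refine iSup_le fun q => ?_
      rw [MeasurableSpace.comap_comp]
      exact le_iSup₂_of_le (e q) (Set.mem_range_self q) le_rfl
    · rw [MeasurableSpace.pi, MeasurableSpace.comap_iSup]
      refine iSup_le fun p => ?_
      rw [MeasurableSpace.comap_comp]
      exact le_iSup₂_of_le p.1 p.2 le_rfl
  have hAB' := (indepFun_iff_map_prod_eq_prod_map_map hA.aemeasurable hB.aemeasurable).1 hAB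
  have := Measure.isProbabilityMeasure_map (μ := μ) hA.aemeasurable
  have := Measure.isProbabilityMeasure_map (μ := μ) hB.aemeasurable
  have hlow : (lowerParams l : Params n k P → _) = Prod.map B id := rfl
  have hup : (fun θ : Params n k P => fun q => θ.1 (e q)) = A ∘ Prod.fst := rfl
  rw [indepFun_iff_map_prod_eq_prod_map_map (hup ▸ (hA.comp measurable_fst).aemeasurable)
    (measurable_lowerParams l).aemeasurable]
  have h1 : (fun θ : Params n k P => ((fun q => θ.1 (e q)), lowerParams l θ)) =
      MeasurableEquiv.prodAssoc ∘ Prod.map (fun g => (A g, B g)) id := rfl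
  rw [h1, hup, hlow, ← Measure.map_map (MeasurableEquiv.measurable _) (by fun_prop),
    ← Measure.map_map hA measurable_fst, initLaw, Measure.map_fst_prod,
    ← Measure.map_prod_map _ _ (by fun_prop) measurable_id,
    ← Measure.map_prod_map _ _ hB measurable_id, hAB', Measure.map_id, Measure.prodAssoc_prod]
  simp [μ]

theorem indepFun_of_measurable_lowerAlgebra {κ κ' : Type*} {e : κ → ParamIdx n k} {l : ℕ}
    (he : ∀ q, (e q).layer = l) {Y : Params n k P → κ' → ℝ}
    (hY : ∀ q, Measurable[lowerAlgebra n k P l] fun θ => Y θ q) :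
    IndepFun (fun θ : Params n k P => fun q => θ.1 (e q)) Y (initLaw n k ν) := by
  refine indep_of_indep_of_le_right (indepFun_lowerParams ν he) ?_
  have : Measurable[lowerAlgebra n k P l] Y :=
    @measurable_pi_lambda _ _ _ (lowerAlgebra n k P l) _ _ hY
  exact this.comap_le

end

end ParameterIndependence

/-! ### The conditional law of a layer -/

section ConditionalLaw

variable {n k : ℕ} {P : Type*} [MeasurableSpace P]
  {φ : EuclideanSpace ℝ (Fin n) → P → EuclideanSpace ℝ (Fin k)} {a : ℝ → ℝ}

theorem lowerAlgebra_mono : Monotone (lowerAlgebra n k P) := fun l l' h => by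
  let r : ({p : ParamIdx n k // p.layer < l'} → ℝ) × (ℕ → P) →
      ({p : ParamIdx n k // p.layer < l} → ℝ) × (ℕ → P) :=
    fun q => (fun p => q.1 ⟨p.1, p.2.trans_le h⟩, q.2)
  have hr : Measurable r := by fun_prop
  have hrl : Measurable[lowerAlgebra n k P l'] (r ∘ lowerParams l') :=
    hr.comp (comap_measurable (lowerParams l'))
  exact hrl.comap_le

theorem measurable_lowerAlgebra_preact (hφ : ∀ x, Measurable (φ x)) (ha : Measurable a)
    (d : ℕ → ℕ) : ∀ l i x, Measurable[lowerAlgebra n k P (l + 1)] fun θ => preact φ a d θ l i x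
  | 0, i, x => by
    simp only [preact]
    refine (measurable_lowerAlgebra_param (Nat.lt_succ_self _)).add ?_
    refine Finset.measurable_fun_sum _ fun c _ => ?_
    exact (measurable_lowerAlgebra_param (Nat.lt_succ_self _)).mul_const _
  | 1, i, x => by
    simp only [preact]
    refine (measurable_lowerAlgebra_param (Nat.lt_succ_self _)).add (Measurable.const_mul ?_ _)
    refine Finset.measurable_fun_sum _ fun j _ => Finset.measurable_fun_sum _ fun c _ => ?_
    refine (measurable_lowerAlgebra_param (Nat.lt_succ_self _)).mul ?_
    have : Measurable fun w => φ x w c := by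
      have := hφ x
      fun_prop
    exact this.comp (measurable_lowerAlgebra_feature _ j)
  | l + 2, i, x => by
    simp only [preact]
    refine (measurable_lowerAlgebra_param (Nat.lt_succ_self _)).add (Measurable.const_mul ?_ _)
    refine Finset.measurable_fun_sum _ fun j _ => ?_
    refine (measurable_lowerAlgebra_param (Nat.lt_succ_self _)).mul (ha.comp ?_)
    exact (measurable_lowerAlgebra_preact hφ ha d (l + 1) j x).mono
      (lowerAlgebra_mono (Nat.le_succ _)) le_rfl

omit [MeasurableSpace P] in
/-- The bias bounds the conditional variances of the pre-activations from below. -/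
theorem one_le_empiricalCK (d : ℕ → ℕ) (θ : Params n k P) (l : ℕ)
    (x : EuclideanSpace ℝ (Fin n)) : 1 ≤ empiricalCK φ a d θ l x x := by
  match l with
  | 0 => simp [empiricalCK]
  | 1 =>
    simp only [empiricalCK, le_add_iff_nonneg_left]
    exact mul_nonneg (by positivity) (Finset.sum_nonneg fun j _ => real_inner_self_nonneg)
  | l + 2 =>
    simp only [empiricalCK, le_add_iff_nonneg_left]
    exact mul_nonneg (by positivity) (Finset.sum_nonneg fun j _ => mul_self_nonneg _)

/-- Each layer is linear in its own parameters: the pre-activations of layer `l` are linear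
combinations of pairwise distinct parameters of that layer, with coefficients `y` which depend
only on the parameters below and whose Gram kernel is the conjugate kernel. -/
theorem exists_layer_representation (hφ : ∀ x, Measurable (φ x)) (ha : Measurable a) (d : ℕ → ℕ)
    (l : ℕ) :
    ∃ (F : Type) (_ : Fintype F) (e : ℕ × F → ParamIdx n k)
      (y : F → EuclideanSpace ℝ (Fin n) → Params n k P → ℝ),
      Function.Injective e ∧ (∀ q, (e q).layer = l) ∧
      (∀ p x, Measurable[lowerAlgebra n k P l] (y p x)) ∧
      (∀ i x θ, preact φ a d θ l i x = ∑ p, θ.1 (e (i, p)) * y p x θ) ∧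
      ∀ x x' θ, empiricalCK φ a d θ l x x' = ∑ p, y p x θ * y p x' θ := by
  have hpre := measurable_lowerAlgebra_preact hφ ha d
  match l with
  | 0 =>
    refine ⟨Option (Fin n), inferInstance,
      fun q => q.2.elim (.bias 0 q.1) (.inputWeight q.1),
      fun p x _ => p.elim 1 x, ?_, ?_, fun p x => measurable_const, fun i x θ => ?_,
      fun x x' θ => ?_⟩
    · rintro ⟨i, _ | c⟩ ⟨i', _ | c'⟩ h <;> simp_all
    · rintro ⟨i, _ | c⟩ <;> rfl
    · simp [preact, Fintype.sum_option]
    · simp [empiricalCK, Fintype.sum_option, PiLp.inner_apply, add_comm, mul_comm]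
  | 1 =>
    refine ⟨Option (Fin (d 1) × Fin k), inferInstance,
      fun q => q.2.elim (.bias 1 q.1) fun r => .featureWeight q.1 r.1 r.2,
      fun p x θ => p.elim 1 fun r => 1 / √(d 1 : ℝ) * φ x (θ.2 r.1) r.2, ?_, ?_, ?_,
      fun i x θ => ?_, fun x x' θ => ?_⟩
    · rintro ⟨i, _ | c⟩ ⟨i', _ | c'⟩ h <;> simp_all [Prod.ext_iff, Fin.ext_iff]
    · rintro ⟨i, _ | c⟩ <;> rfl
    · rintro (_ | r) x
      · exact measurable_const
      · have : Measurable fun w => 1 / √(d 1 : ℝ) * φ x w r.2 := by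
          have := hφ x
          fun_prop
        exact this.comp (measurable_lowerAlgebra_feature 1 r.1)
    · simp only [preact, Fintype.sum_option, Option.elim, mul_one, Finset.mul_sum,
        Fintype.sum_prod_type, Finset.sum_range]
      congr 1
      exact Finset.sum_congr rfl fun j _ => Finset.sum_congr rfl fun c _ => by ring
    · simp only [empiricalCK, Fintype.sum_option, Option.elim, mul_one, Finset.mul_sum,
        Fintype.sum_prod_type, Finset.sum_range, PiLp.inner_apply]
      rw [add_comm]
      congr 1
      refine Finset.sum_congr rfl fun j _ => Finset.sum_congr rfl fun c _ => ?_
      rw [mul_mul_mul_comm, div_mul_div_comm, Real.mul_self_sqrt (by positivity)]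
      simp [mul_comm]
  | l + 2 =>
    refine ⟨Option (Fin (d (l + 2))), inferInstance,
      fun q => q.2.elim (.bias (l + 2) q.1) fun j => .weight (l + 2) q.1 j,
      fun p x θ => p.elim 1 fun j => 1 / √(d (l + 2) : ℝ) * a (preact φ a d θ (l + 1) j x),
      ?_, ?_, ?_, fun i x θ => ?_, fun x x' θ => ?_⟩
    · rintro ⟨i, _ | c⟩ ⟨i', _ | c'⟩ h <;> simp_all [Fin.ext_iff]
    · rintro ⟨i, _ | c⟩ <;> rfl
    · rintro (_ | r) x
      · exact measurable_const
      · exact (ha.const_mul _).comp (hpre (l + 1) r x)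
    · simp only [preact, Fintype.sum_option, Option.elim, mul_one, Finset.mul_sum,
        Finset.sum_range]
      congr 1
      exact Finset.sum_congr rfl fun j _ => by ring
    · simp only [empiricalCK, Fintype.sum_option, Option.elim, mul_one, Finset.mul_sum,
        Finset.sum_range]
      rw [add_comm]
      congr 1
      refine Finset.sum_congr rfl fun j _ => ?_
      rw [mul_mul_mul_comm, div_mul_div_comm, Real.mul_self_sqrt (by positivity)]
      simp

theorem measurable_preact (hφ : ∀ x, Measurable (φ x)) (ha : Measurable a)
    (d : ℕ → ℕ) (l i x) : Measurable fun θ => preact φ a d θ l i x :=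
  (measurable_lowerAlgebra_preact hφ ha d l i x).mono (lowerAlgebra_le _) le_rfl

theorem measurable_empiricalCK (hφ : ∀ x, Measurable (φ x)) (ha : Measurable a)
    (d : ℕ → ℕ) (l x x') : Measurable fun θ => empiricalCK φ a d θ l x x' := by
  obtain ⟨F, _, e, y, -, -, hy, -, hCK⟩ := exists_layer_representation hφ ha d l
  simp only [hCK]
  exact Finset.measurable_fun_sum _ fun p _ =>
    ((hy p x).mono (lowerAlgebra_le _) le_rfl).mul ((hy p x').mono (lowerAlgebra_le _) le_rfl)

theorem sum_ite_eq_image {κ : Type*} [Fintype κ] (i : κ → ℕ) (q : κ) (g : ℕ → ℝ) :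
    ∑ j : Finset.univ.image i, (if i q = j then g j else 0) = g (i q) := by
  rw [Finset.sum_coe_sort (Finset.univ.image i) fun j => if i q = j then g j else 0,
    Finset.sum_ite_eq, if_pos (Finset.mem_image_of_mem _ (Finset.mem_univ q))]

/-- Squares of combinations which are grouped by the label `i q`, as a double sum over pairs with
equal labels. -/
theorem sum_sq_sum_ite {κ F : Type*} [Fintype κ] [Fintype F] (i : κ → ℕ) (c : κ → F → ℝ) :
    ∑ j : Finset.univ.image i, ∑ p, (∑ q, if i q = j then c q p else 0) ^ 2 =
      ∑ q, ∑ q', if i q = i q' then ∑ p, c q p * c q' p else 0 := by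
  set J := Finset.univ.image i
  calc _ = ∑ j : J, ∑ p, ∑ q, ∑ q', (if i q = j then c q p *
          (if i q' = j then c q' p else 0) else 0) := by
        simp only [sq, Finset.sum_mul_sum, ite_mul, zero_mul]
    _ = ∑ q, ∑ q', ∑ p, ∑ j : J, (if i q = j then c q p *
          (if i q' = j then c q' p else 0) else 0) := by
        rw [Finset.sum_comm]
        simp only [Finset.sum_comm (s := (Finset.univ : Finset J)) (t := (Finset.univ : Finset κ))]
        rw [Finset.sum_comm]
        exact Finset.sum_congr rfl fun q _ => Finset.sum_comm
    _ = _ := by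
        refine Finset.sum_congr rfl fun q _ => Finset.sum_congr rfl fun q' _ => ?_
        refine (Finset.sum_congr rfl fun p _ => sum_ite_eq_image i q fun j => c q p *
          (if i q' = j then c q' p else 0)).trans ?_
        simp only [eq_comm (a := i q')]
        split_ifs
        · rfl
        · simp

/-- The conjugate kernel is positive semidefinite, jointly over neurons and inputs. -/
theorem sum_empiricalCK_nonneg (hφ : ∀ x, Measurable (φ x)) (ha : Measurable a) (d : ℕ → ℕ) (l : ℕ)
    {κ : Type*} [Fintype κ] (s : κ → ℕ × EuclideanSpace ℝ (Fin n)) (u : κ → ℝ)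
    (θ : Params n k P) :
    0 ≤ ∑ q, ∑ q', u q * u q' *
        (if (s q).1 = (s q').1 then empiricalCK φ a d θ l (s q).2 (s q').2 else 0) := by
  obtain ⟨F, _, e, y, -, -, -, -, hCK⟩ := exists_layer_representation hφ ha d l
  have h := sum_sq_sum_ite (fun q => (s q).1) fun q (p : F) => u q * y p (s q).2 θ
  calc 0 ≤ _ := Finset.sum_nonneg fun j _ => Finset.sum_nonneg fun p _ => sq_nonneg _
    _ = _ := h
    _ = _ := by
      refine Finset.sum_congr rfl fun q _ => Finset.sum_congr rfl fun q' _ => ?_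
      simp only [mul_ite, mul_zero, hCK, Finset.mul_sum]
      congr 1
      exact Finset.sum_congr rfl fun p _ => by ring

variable (ν : Measure P) [IsProbabilityMeasure ν]

/-- Conditionally on the inputs of layer `l`, its pre-activations are jointly centred Gaussian;
neurons are independent, and the covariance of one neuron is the conjugate kernel. -/
theorem charFun_map_preact (hφ : ∀ x, Measurable (φ x)) (ha : Measurable a) (d : ℕ → ℕ) (l : ℕ)
    {κ : Type*} [Fintype κ] (s : κ → ℕ × EuclideanSpace ℝ (Fin n)) (u : EuclideanSpace ℝ κ) :
    charFun ((initLaw n k ν).map fun θ =>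
        (WithLp.toLp 2 fun q => preact φ a d θ l (s q).1 (s q).2 : EuclideanSpace ℝ κ)) u =
      ∫ θ, Complex.exp (-((∑ q, ∑ q', u q * u q' *
        (if (s q).1 = (s q').1 then empiricalCK φ a d θ l (s q).2 (s q').2 else 0) : ℝ) : ℂ) / 2)
          ∂initLaw n k ν := by
  obtain ⟨F, _, e, y, he, hel, hy, hpre, hCK⟩ := exists_layer_representation hφ ha d l
  -- A linear combination of pre-activations, collected by neuron `j ∈ J` and parameter `p ∈ F`: the
  -- coefficient of the parameter `e (j, p)` is `Y θ (j, p)`.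
  let J := Finset.univ.image fun q => (s q).1
  let e' : J × F → ParamIdx n k := fun r => e (r.1, r.2)
  have he' : Function.Injective e' := fun r r' h => by
    have := he h
    simp only [Prod.ext_iff, Subtype.ext_iff] at this ⊢
    exact this
  let Y : Params n k P → J × F → ℝ := fun θ r =>
    ∑ q, if (s q).1 = r.1 then u q * y r.2 (s q).2 θ else 0
  have hYl (r) : Measurable[lowerAlgebra n k P l] fun θ => Y θ r := by
    refine Finset.measurable_fun_sum _ fun q _ => ?_
    split_ifs
    · exact (hy r.2 _).const_mul _
    · exact measurable_const
  have hY : Measurable Y := measurable_pi_lambda _ fun r => (hYl r).mono (lowerAlgebra_le _) le_rfl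
  have hm : Measurable fun θ =>
      (WithLp.toLp 2 fun q => preact φ a d θ l (s q).1 (s q).2 : EuclideanSpace ℝ κ) := by
    have := fun q => measurable_preact hφ ha d l (s q).1 (s q).2
    fun_prop
  rw [charFun_apply, integral_map hm.aemeasurable
    (Measurable.stronglyMeasurable (by fun_prop)).aestronglyMeasurable]
  have key := integral_cexp_sum_mul_of_indepFun (U := fun θ r => θ.1 (e' r)) (by fun_prop) hY
    (map_param_initLaw ν he')
    (indepFun_of_measurable_lowerAlgebra ν (fun r => hel _) hYl)
  convert key using 2
  · ext θ
    congr 2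
    norm_cast
    simp only [PiLp.inner_apply, hpre, Fintype.sum_prod_type, Y, Finset.mul_sum]
    symm
    calc _ = ∑ j : J, ∑ q, ∑ p, θ.1 (e (j, p)) *
            (if (s q).1 = j then u q * y p (s q).2 θ else 0) :=
          Finset.sum_congr rfl fun j _ => Finset.sum_comm
      _ = ∑ q, ∑ p, ∑ j : J,
            (if (s q).1 = j then θ.1 (e (j, p)) * (u q * y p (s q).2 θ) else 0) := by
          rw [Finset.sum_comm]
          refine Finset.sum_congr rfl fun q _ => ?_
          rw [Finset.sum_comm]
          simp only [mul_ite, mul_zero]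
      _ = _ := by
          refine Finset.sum_congr rfl fun q _ => ?_
          refine (Finset.sum_congr rfl fun p _ =>
            sum_ite_eq_image (fun q => (s q).1) q fun j =>
              θ.1 (e (j, p)) * (u q * y p (s q).2 θ)).trans ?_
          simp only [RCLike.inner_apply, conj_trivial, Finset.mul_sum]
          exact Finset.sum_congr rfl fun p _ => by ring
  · ext θ
    congr 3
    norm_cast
    simp only [Fintype.sum_prod_type, Y]
    refine Eq.trans ?_ (sum_sq_sum_ite (fun q => (s q).1) fun q p => u q * y p (s q).2 θ).symm
    refine Finset.sum_congr rfl fun q _ => Finset.sum_congr rfl fun q' _ => ?_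
    simp only [mul_ite, mul_zero, hCK, Finset.mul_sum]
    congr 1
    exact Finset.sum_congr rfl fun p _ => by ring

/-- The contribution of the event that the conditional variance of a neuron is at most `V` to the
expectation of a function of its pre-activation is controlled by the Gaussian law of variance `V`.
-/ theorem lintegral_preact_le (hφ : ∀ x, Measurable (φ x)) (ha : Measurable a) (d : ℕ → ℕ) (l i :
ℕ) (x : EuclideanSpace ℝ (Fin n)) {h : ℝ → ENNReal} (hh : Measurable h) (V : NNReal) :
    ∫⁻ θ, (if empiricalCK φ a d θ l x x ≤ V then h (preact φ a d θ l i x) else 0)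
        ∂initLaw n k ν ≤ ENNReal.ofReal √V * ∫⁻ z, h z ∂gaussianReal 0 V := by
  obtain ⟨F, _, e, y, he, hel, hy, hpre, hCK⟩ := exists_layer_representation hφ ha d l
  have he' : Function.Injective fun p => e (i, p) := fun p p' h => by simpa using he h
  let Y : Params n k P → F → ℝ := fun θ p => y p x θ
  have hY : Measurable Y :=
    measurable_pi_lambda _ fun r => (hy r x).mono (lowerAlgebra_le _) le_rfl
  let H : (F → ℝ) → ℝ → ENNReal := fun y z => if ∑ p, y p ^ 2 ≤ V then h z else 0
  have hH : Measurable (Function.uncurry H) :=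
    Measurable.ite (measurableSet_le (by fun_prop) measurable_const) (by fun_prop)
      measurable_const
  have key := lintegral_sum_mul_of_indepFun (U := fun θ p => θ.1 (e (i, p))) (by fun_prop) hY
    (map_param_initLaw ν he')
    (indepFun_of_measurable_lowerAlgebra ν (fun r => hel _) fun p => hy p x) hH
  have hsq (θ) : empiricalCK φ a d θ l x x = ∑ p, Y θ p ^ 2 := by simp [hCK, Y, sq]
  simp only [hsq, hpre]
  refine key.le.trans ?_
  refine (lintegral_mono fun θ => ?_).trans_eq (lintegral_const _ |>.trans (by simp; rfl))
  by_cases hV : ∑ p, Y θ p ^ 2 ≤ V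
  · simp only [H, hV, if_true]
    refine lintegral_gaussianReal_le ?_ (Real.toNNReal_le_iff_le_coe.2 hV) h
    rw [Real.one_le_toNNReal, ← hsq]
    exact one_le_empiricalCK d θ l x
  · simp [H, hV]

end ConditionalLaw

/-! ### Convergence in probability -/

section ConvergenceInProbability

section Convergence

variable {Ω : Type*} [MeasurableSpace Ω] {μ : Measure Ω}

/-- Continuous mapping theorem for convergence in probability of finitely many sequences to
constants. -/
theorem tendstoInMeasure_comp_of_continuousAt {ι : Type*} [Fintype ι] {X : ι → ℕ → Ω → ℝ}
    {c : ι → ℝ} (h : ∀ i, TendstoInMeasure μ (X i) atTop fun _ => c i) {g : (ι → ℝ) → ℝ}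
    (hg : ContinuousAt g c) :
    TendstoInMeasure μ (fun t ω => g fun i => X i t ω) atTop fun _ => g c := by
  rw [tendstoInMeasure_iff_dist]
  intro ε hε
  obtain ⟨δ, hδ, hδg⟩ := Metric.continuousAt_iff.1 hg ε hε
  have hsum : Tendsto (fun t => ∑ i, μ {ω | δ ≤ dist (X i t ω) (c i)}) atTop (𝓝 0) := by
    simpa using tendsto_finsetSum Finset.univ fun i _ => tendstoInMeasure_iff_dist.1 (h i) δ hδ
  refine tendsto_of_tendsto_of_tendsto_of_le_of_le tendsto_const_nhds hsum (fun _ => zero_le)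
    fun t => ?_
  refine (measure_mono fun ω hω => ?_).trans
    (measure_iUnion_fintype_le μ fun i => {ω | δ ≤ dist (X i t ω) (c i)})
  by_contra hcon
  simp only [Set.mem_iUnion, Set.mem_ofPred_eq, not_exists, not_le] at hcon hω
  exact absurd (hδg ((dist_pi_lt_iff hδ).2 hcon)) (not_lt.2 hω)

theorem tendsto_measure_setOf_gt_of_tendstoInMeasure {X : ℕ → Ω → ℝ} {c V : ℝ}
    (h : TendstoInMeasure μ X atTop fun _ => c) (hV : c < V) :
    Tendsto (fun t => μ {ω | V < X t ω}) atTop (𝓝 0) := by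
  refine tendsto_of_tendsto_of_tendsto_of_le_of_le tendsto_const_nhds
    (tendstoInMeasure_iff_dist.1 h (V - c) (sub_pos.2 hV)) (fun _ => zero_le) fun t => ?_
  refine measure_mono fun ω hω => ?_
  simp only [Set.mem_ofPred_eq, Real.dist_eq] at hω ⊢
  exact (sub_le_sub_right (le_of_lt hω) c).trans (le_abs_self _)

/-- Convergence in probability can be checked on approximations which are close to the sequence with
high probability. -/
theorem tendstoInMeasure_of_approx {Y : ℕ → Ω → ℝ} {m : ℝ}
    (h : ∀ ε > 0, ∀ η : ENNReal, 0 < η → ∃ (Z : ℕ → Ω → ℝ) (c : ℝ),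
      TendstoInMeasure μ Z atTop (fun _ => c) ∧ |c - m| ≤ ε ∧
      ∀ᶠ t in atTop, μ {ω | ε ≤ |Y t ω - Z t ω|} ≤ η) :
    TendstoInMeasure μ Y atTop fun _ => m := by
  rw [tendstoInMeasure_iff_dist]
  intro ε hε
  rw [ENNReal.tendsto_nhds_zero]
  intro η hη
  obtain ⟨Z, c, hZ, hc, hYZ⟩ := h (ε / 3) (by positivity) (η / 2) (ENNReal.half_pos hη.ne')
  have hZ' := ENNReal.tendsto_nhds_zero.1
    (tendstoInMeasure_iff_dist.1 hZ (ε / 3) (by positivity)) (η / 2) (ENNReal.half_pos hη.ne')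
  filter_upwards [hYZ, hZ'] with t h1 h2
  calc μ {ω | ε ≤ dist (Y t ω) m}
      ≤ μ ({ω | ε / 3 ≤ |Y t ω - Z t ω|} ∪ {ω | ε / 3 ≤ dist (Z t ω) c}) := by
        refine measure_mono fun ω hω => ?_
        by_contra hcon
        simp only [Set.mem_union, Set.mem_ofPred_eq, not_or, not_le, Real.dist_eq] at hcon hω
        have := abs_sub_le (Y t ω) (Z t ω) m
        have := abs_sub_le (Z t ω) c m
        linarith [hcon.1, hcon.2]
    _ ≤ η / 2 + η / 2 := (measure_union_le _ _).trans (add_le_add h1 h2)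
    _ = η := ENNReal.add_halves η

variable [IsProbabilityMeasure μ]

/-- Convergence in mean square implies convergence in probability. -/
theorem tendstoInMeasure_of_tendsto_integral_sq {X : ℕ → Ω → ℝ} {c : ℝ}
    (hint : ∀ t, Integrable (fun ω => (X t ω - c) ^ 2) μ)
    (h : Tendsto (fun t => ∫ ω, (X t ω - c) ^ 2 ∂μ) atTop (𝓝 0)) :
    TendstoInMeasure μ X atTop fun _ => c := by
  rw [tendstoInMeasure_iff_measureReal_dist]
  intro ε hε
  have h' : Tendsto (fun t => (∫ ω, (X t ω - c) ^ 2 ∂μ) / ε ^ 2) atTop (𝓝 0) := by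
    simpa using h.div_const (ε ^ 2)
  refine tendsto_of_tendsto_of_tendsto_of_le_of_le tendsto_const_nhds h'
    (fun _ => measureReal_nonneg) fun t => ?_
  have hset : {ω | ε ≤ dist (X t ω) c} = {ω | ε ^ 2 ≤ (X t ω - c) ^ 2} := by
    ext ω
    rw [Set.mem_ofPred_eq, Set.mem_ofPred_eq, Real.dist_eq, ← sq_abs (X t ω - c),
      sq_le_sq₀ hε.le (abs_nonneg _)]
  rw [le_div_iff₀ (by positivity), hset, mul_comm]
  exact mul_meas_ge_le_integral_of_nonneg (ae_of_all _ fun ω => sq_nonneg _) (hint t) _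

/-- Weak law of large numbers for the rows of an array of bounded variables: it is enough that the
means and the mixed second moments are constant along each row, and asymptotically those of
uncorrelated variables. -/
theorem tendstoInMeasure_average_of_array {X : ℕ → ℕ → Ω → ℝ} {M m : ℝ} {p q : ℕ → ℝ} {N : ℕ → ℕ}
    (hX : ∀ t j, Measurable (X t j)) (hM : ∀ t j ω, |X t j ω| ≤ M)
    (hp : ∀ t j, ∫ ω, X t j ω ∂μ = p t)
    (hq : ∀ t i j, i ≠ j → ∫ ω, X t i ω * X t j ω ∂μ = q t)
    (hpm : Tendsto p atTop (𝓝 m)) (hqm : Tendsto q atTop (𝓝 (m ^ 2)))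
    (hN : Tendsto N atTop atTop) :
    TendstoInMeasure μ (fun t ω => 1 / (N t : ℝ) * ∑ j ∈ Finset.range (N t), X t j ω) atTop
      fun _ => m := by
  have hM0 (t j ω) : 0 ≤ M := (abs_nonneg _).trans (hM t j ω)
  have hi1 (t j) : Integrable (X t j) μ :=
    Integrable.of_bound (hX t j).aestronglyMeasurable M (ae_of_all _ (hM t j))
  have hb2 (t i j ω) : |X t i ω * X t j ω| ≤ M ^ 2 := by
    rw [abs_mul, sq]
    exact mul_le_mul (hM t i ω) (hM t j ω) (abs_nonneg _) (hM0 t i ω)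
  have hi2 (t i j) : Integrable (fun ω => X t i ω * X t j ω) μ :=
    Integrable.of_bound ((hX t i).mul (hX t j)).aestronglyMeasurable (M ^ 2)
      (ae_of_all _ (hb2 t i j))
  have hexp (t ω) : (1 / (N t : ℝ) * ∑ j ∈ Finset.range (N t), X t j ω - m) ^ 2 =
      (1 / (N t : ℝ)) ^ 2 * ∑ i ∈ Finset.range (N t), ∑ j ∈ Finset.range (N t), X t i ω * X t j ω
        - 2 * m * (1 / (N t : ℝ)) * ∑ j ∈ Finset.range (N t), X t j ω + m ^ 2 := by
    rw [← Finset.sum_mul_sum]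
    ring
  have hI1 (t) : Integrable (fun ω => ∑ j ∈ Finset.range (N t), X t j ω) μ :=
    integrable_finsetSum _ fun j _ => hi1 t j
  have hI2 (t) : Integrable (fun ω => ∑ i ∈ Finset.range (N t), ∑ j ∈ Finset.range (N t),
      X t i ω * X t j ω) μ :=
    integrable_finsetSum _ fun i _ => integrable_finsetSum _ fun j _ => hi2 t i j
  have hI3 (t) : Integrable (fun ω => (1 / (N t : ℝ)) ^ 2 * ∑ i ∈ Finset.range (N t),
      ∑ j ∈ Finset.range (N t), X t i ω * X t j ω -
        2 * m * (1 / (N t : ℝ)) * ∑ j ∈ Finset.range (N t), X t j ω) μ :=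
    ((hI2 t).const_mul ((1 / (N t : ℝ)) ^ 2)).sub ((hI1 t).const_mul (2 * m * (1 / (N t : ℝ))))
  refine tendstoInMeasure_of_tendsto_integral_sq (fun t => ?_) ?_
  · simp only [hexp]
    exact (hI3 t).add (integrable_const _)
  have hNinv : Tendsto (fun t => (N t : ℝ)⁻¹) atTop (𝓝 0) :=
    tendsto_inv_atTop_zero.comp (tendsto_natCast_atTop_atTop.comp hN)
  -- The mean square error is at most `q + (M² - q) / N - 2 m p + m²`: the off-diagonal terms of the
  -- double sum contribute `q` each, the `N` diagonal ones at most `M²`.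
  have hlim : Tendsto (fun t => q t + (M ^ 2 - q t) * (N t : ℝ)⁻¹ - 2 * m * p t + m ^ 2) atTop
      (𝓝 0) := by
    have := ((hqm.add ((hqm.const_sub (M ^ 2)).mul hNinv)).sub (hpm.const_mul (2 * m))).add_const
      (m ^ 2)
    convert this using 2
    ring
  refine tendsto_of_tendsto_of_tendsto_of_le_of_le' tendsto_const_nhds hlim
    (Eventually.of_forall fun t => integral_nonneg fun ω => sq_nonneg _) ?_
  filter_upwards [hN.eventually_gt_atTop 0] with t ht
  have ht' : (0 : ℝ) < N t := by exact_mod_cast ht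
  simp only [hexp]
  rw [integral_add (hI3 t) (integrable_const _),
    integral_sub ((hI2 t).const_mul _) ((hI1 t).const_mul _), integral_const_mul,
    integral_const_mul, integral_finsetSum _ fun j _ => hi1 t j,
    integral_finsetSum _ fun i _ => integrable_finsetSum _ fun j _ => hi2 t i j]
  simp only [integral_finsetSum _ fun j _ => hi2 t _ j, hp, integral_const, probReal_univ,
    one_smul, Finset.sum_const, Finset.card_range, nsmul_eq_mul]
  have hdouble : ∑ i ∈ Finset.range (N t), ∑ j ∈ Finset.range (N t), ∫ ω, X t i ω * X t j ω ∂μ ≤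
      N t * (N t * q t + (M ^ 2 - q t)) := by
    calc _ ≤ ∑ i ∈ Finset.range (N t), ∑ j ∈ Finset.range (N t),
          (q t + if i = j then M ^ 2 - q t else 0) := by
          refine Finset.sum_le_sum fun i _ => Finset.sum_le_sum fun j _ => ?_
          split_ifs with hij
          · rw [add_sub_cancel]
            refine (integral_mono (hi2 t i j) (integrable_const (M ^ 2))
              fun ω => (le_abs_self _).trans (hb2 t i j ω)).trans_eq (by simp)
          · rw [add_zero, hq t i j hij]
      _ = ∑ i ∈ Finset.range (N t), (N t * q t + (M ^ 2 - q t)) := by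
          refine Finset.sum_congr rfl fun i hi => ?_
          rw [Finset.sum_add_distrib, Finset.sum_ite_eq, if_pos hi]
          simp
      _ = _ := by rw [Finset.sum_const, Finset.card_range, nsmul_eq_mul]
  have h1 : (1 / (N t : ℝ)) ^ 2 * (N t * (N t * q t + (M ^ 2 - q t))) =
      q t + (M ^ 2 - q t) * (N t : ℝ)⁻¹ := by
    field_simp
  have h2 : 2 * m * (1 / (N t : ℝ)) * (N t * p t) = 2 * m * p t := by
    field_simp
  rw [h2, ← h1]
  gcongr

/-- If nonnegative variances converge in probability to a constant, then the characteristic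
functions of the corresponding Gaussian mixtures converge. -/
theorem tendsto_integral_cexp_of_tendstoInMeasure {A : ℕ → Ω → ℝ} {v : ℝ}
    (hA : ∀ t, Measurable (A t)) (h0 : ∀ t ω, 0 ≤ A t ω) (hv : 0 ≤ v)
    (h : TendstoInMeasure μ A atTop fun _ => v) :
    Tendsto (fun t => ∫ ω, Complex.exp (-(A t ω : ℂ) / 2) ∂μ) atTop
      (𝓝 (Complex.exp (-(v : ℂ) / 2))) := by
  have hd := (h.tendstoInDistribution fun t => (hA t).aemeasurable).tendsto
  -- `r ↦ exp (-r / 2)` is bounded on `[0, ∞)` only, where the variances live.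
  let f : BoundedContinuousFunction ℝ ℂ :=
    BoundedContinuousFunction.ofNormedAddCommGroup
      (fun r => Complex.exp (-((max r 0 : ℝ) : ℂ) / 2)) (by fun_prop) 1 fun r => by
        rw [Complex.norm_exp, Real.exp_le_one_iff]
        simp [neg_div]
        positivity
  have hf := (ProbabilityMeasure.tendsto_iff_forall_integral_rclike_tendsto ℂ).1 hd f
  simp only [ProbabilityMeasure.coe_mk] at hf
  rw [integral_map (by fun_prop) f.continuous.aestronglyMeasurable] at hf
  simp only [integral_map (hA _).aemeasurable f.continuous.aestronglyMeasurable] at hf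
  simpa [f, max_eq_left hv, max_eq_left (h0 _ _)] using hf

end Convergence

end ConvergenceInProbability

/-! ### The limit of a layer with convergent conjugate kernel -/

section LayerLimit

/-- The covariance of independent copies, indexed by the neurons of a layer, of a centred process
with covariance `S`. -/
abbrev neuronKernel {T : Type*} (S : T → T → ℝ) (s s' : ℕ × T) : ℝ :=
  if s.1 = s'.1 then S s.2 s'.2 else 0

variable {n k : ℕ} {P : Type*} [MeasurableSpace P]
  {φ : EuclideanSpace ℝ (Fin n) → P → EuclideanSpace ℝ (Fin k)} {a : ℝ → ℝ}
  (ν : Measure P) [IsProbabilityMeasure ν]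

theorem measurable_toLp_preact (hφ : ∀ x, Measurable (φ x)) (ha : Measurable a) (d : ℕ → ℕ) (l : ℕ)
    {κ : Type*} [Fintype κ] (s : κ → ℕ × EuclideanSpace ℝ (Fin n)) :
    Measurable fun θ =>
      (WithLp.toLp 2 fun q => preact φ a d θ l (s q).1 (s q).2 : EuclideanSpace ℝ κ) := by
  have := fun q => measurable_preact hφ ha d l (s q).1 (s q).2
  fun_prop

/-- The joint law of pre-activations does not change when the neurons are relabelled injectively. -/
theorem map_preact_congr (hφ : ∀ x, Measurable (φ x)) (ha : Measurable a) (d : ℕ → ℕ) (l : ℕ)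
    {κ : Type*} [Fintype κ] {s s' : κ → ℕ × EuclideanSpace ℝ (Fin n)}
    (h1 : ∀ q q', (s q).1 = (s q').1 ↔ (s' q).1 = (s' q').1) (h2 : ∀ q, (s q).2 = (s' q).2) :
    (initLaw n k ν).map (fun θ =>
        (WithLp.toLp 2 fun q => preact φ a d θ l (s q).1 (s q).2 : EuclideanSpace ℝ κ)) =
      (initLaw n k ν).map (fun θ =>
        (WithLp.toLp 2 fun q => preact φ a d θ l (s' q).1 (s' q).2 : EuclideanSpace ℝ κ)) := by
  have := Measure.isProbabilityMeasure_map (μ := initLaw n k ν)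
    (measurable_toLp_preact hφ ha d l s).aemeasurable
  have := Measure.isProbabilityMeasure_map (μ := initLaw n k ν)
    (measurable_toLp_preact hφ ha d l s').aemeasurable
  apply Measure.ext_of_charFun
  ext u
  rw [charFun_map_preact ν hφ ha, charFun_map_preact ν hφ ha]
  simp only [h1, h2]

theorem integral_preact_congr (hφ : ∀ x, Measurable (φ x)) (ha : Measurable a) (d : ℕ → ℕ) (l : ℕ)
    {κ : Type*} [Fintype κ] {s s' : κ → ℕ × EuclideanSpace ℝ (Fin n)}
    (h1 : ∀ q q', (s q).1 = (s q').1 ↔ (s' q).1 = (s' q').1) (h2 : ∀ q, (s q).2 = (s' q).2)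
    {f : EuclideanSpace ℝ κ → ℝ} (hf : Continuous f) :
    ∫ θ, f (WithLp.toLp 2 fun q => preact φ a d θ l (s q).1 (s q).2) ∂initLaw n k ν =
      ∫ θ, f (WithLp.toLp 2 fun q => preact φ a d θ l (s' q).1 (s' q).2) ∂initLaw n k ν := by
  rw [← integral_map (measurable_toLp_preact hφ ha d l s).aemeasurable hf.aestronglyMeasurable,
    map_preact_congr ν hφ ha d l h1 h2,
    integral_map (measurable_toLp_preact hφ ha d l s').aemeasurable hf.aestronglyMeasurable]

section Limit

variable {S : EuclideanSpace ℝ (Fin n) → EuclideanSpace ℝ (Fin n) → ℝ}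
  {Q : Measure (ℕ × EuclideanSpace ℝ (Fin n) → ℝ)} [IsProbabilityMeasure Q] {d : ℕ → ℕ → ℕ} {l : ℕ}

/-- If the conjugate kernel of a layer converges in probability, then the pre-activations of this
layer converge in distribution to independent Gaussian processes. -/
theorem tendstoInDistribution_preact (hφ : ∀ x, Measurable (φ x)) (ha : Measurable a)
    (hQ : IsCentredGP Q (neuronKernel S))
    (hK : ∀ x x', TendstoInMeasure (initLaw n k ν)
      (fun t θ => empiricalCK φ a (d t) θ l x x') atTop fun _ => S x x')
    {κ : Type*} [Fintype κ] (s : κ → ℕ × EuclideanSpace ℝ (Fin n)) :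
    TendstoInDistribution (fun t θ => (WithLp.toLp 2 fun q =>
        preact φ a (d t) θ l (s q).1 (s q).2 : EuclideanSpace ℝ κ)) atTop
      (fun g => WithLp.toLp 2 fun q => g (s q)) (fun _ => initLaw n k ν) Q := by
  refine ⟨fun t => (measurable_toLp_preact hφ ha (d t) l s).aemeasurable,
    Measurable.aemeasurable (by fun_prop),
    ProbabilityMeasure.tendsto_of_tendsto_charFun fun u => ?_⟩
  simp only [ProbabilityMeasure.coe_mk, charFun_map_preact ν hφ ha, hQ.charFun_map]
  refine tendsto_integral_cexp_of_tendstoInMeasure (fun t => ?_)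
    (fun t θ => sum_empiricalCK_nonneg hφ ha (d t) l s u θ) (hQ.sum_nonneg s u) ?_
  · refine Finset.measurable_fun_sum _ fun q _ => Finset.measurable_fun_sum _ fun q' _ =>
      Measurable.const_mul ?_ _
    split_ifs
    · exact measurable_empiricalCK hφ ha _ _ _ _
    · exact measurable_const
  · exact tendstoInMeasure_comp_of_continuousAt (ι := κ × κ)
      (X := fun r t θ => empiricalCK φ a (d t) θ l (s r.1).2 (s r.2).2)
      (c := fun r => S (s r.1).2 (s r.2).2) (fun r => hK _ _)
      (g := fun c => ∑ q, ∑ q', u q * u q' * if (s q).1 = (s q').1 then c (q, q') else 0)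
      (Continuous.continuousAt (by
        refine continuous_finsetSum _ fun q _ => continuous_finsetSum _ fun q' _ => ?_
        split_ifs <;> fun_prop))

theorem tendsto_integral_preact {κ : Type*} [Fintype κ] {s : κ → ℕ × EuclideanSpace ℝ (Fin n)}
    (h : TendstoInDistribution (fun t θ => (WithLp.toLp 2 fun q =>
        preact φ a (d t) θ l (s q).1 (s q).2 : EuclideanSpace ℝ κ)) atTop
      (fun g => WithLp.toLp 2 fun q => g (s q)) (fun _ => initLaw n k ν) Q)
    {f : EuclideanSpace ℝ κ → ℝ} (hf : Continuous f) {M : ℝ} (hM : ∀ z, |f z| ≤ M) :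
    Tendsto (fun t => ∫ θ, f (WithLp.toLp 2 fun q => preact φ a (d t) θ l (s q).1 (s q).2)
      ∂initLaw n k ν) atTop (𝓝 (∫ g, f (WithLp.toLp 2 fun q => g (s q)) ∂Q)) := by
  have h1 := (ProbabilityMeasure.tendsto_iff_forall_integral_tendsto).1 h.tendsto
    (BoundedContinuousFunction.ofNormedAddCommGroup f hf M hM)
  simp only [ProbabilityMeasure.coe_mk, BoundedContinuousFunction.coe_ofNormedAddCommGroup] at h1
  rw [integral_map h.aemeasurable_limit hf.aestronglyMeasurable] at h1
  simpa only [integral_map (h.forall_aemeasurable _) hf.aestronglyMeasurable] using h1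

/-- Under the limiting law distinct neurons are independent and identically distributed. -/
theorem IsCentredGP.integral_mul_neurons (hQ : IsCentredGP Q (neuronKernel S))
    (x x' : EuclideanSpace ℝ (Fin n)) {G : ℝ → ℝ → ℝ} (hG : Measurable (Function.uncurry G)) :
    ∫ g, G (g (0, x)) (g (0, x')) * G (g (1, x)) (g (1, x')) ∂Q =
      (∫ g, G (g (0, x)) (g (0, x')) ∂Q) ^ 2 := by
  have hlaw : Q.map (fun g => (WithLp.toLp 2 fun q => g (1, ![x, x'] q) :
        EuclideanSpace ℝ (Fin 2))) =
      Q.map (fun g => (WithLp.toLp 2 fun q => g (0, ![x, x'] q) : EuclideanSpace ℝ (Fin 2))) := by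
    have hm (i : ℕ) : Measurable fun g : ℕ × EuclideanSpace ℝ (Fin n) → ℝ =>
        (WithLp.toLp 2 fun q => g (i, ![x, x'] q) : EuclideanSpace ℝ (Fin 2)) := by fun_prop
    have := Measure.isProbabilityMeasure_map (μ := Q) (hm 0).aemeasurable
    have := Measure.isProbabilityMeasure_map (μ := Q) (hm 1).aemeasurable
    apply Measure.ext_of_charFun
    ext u
    rw [hQ.charFun_map (fun q => (1, ![x, x'] q)), hQ.charFun_map (fun q => (0, ![x, x'] q))]
    simp
  have hG2 : Measurable fun z : EuclideanSpace ℝ (Fin 2) => G (z 0) (z 1) :=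
    hG.comp (f := fun z : EuclideanSpace ℝ (Fin 2) => (z 0, z 1)) (by fun_prop)
  have hid : ∫ g, G (g (1, x)) (g (1, x')) ∂Q = ∫ g, G (g (0, x)) (g (0, x')) ∂Q := by
    have h := congrArg (fun ρ => ∫ z, G (z 0) (z 1) ∂ρ) hlaw
    simp only at h
    rw [integral_map (Measurable.aemeasurable (by fun_prop)) hG2.aestronglyMeasurable,
      integral_map (Measurable.aemeasurable (by fun_prop)) hG2.aestronglyMeasurable] at h
    simpa using h
  have hind : IndepFun (fun (g : ℕ × EuclideanSpace ℝ (Fin n) → ℝ) (b : Fin 2) => g (0, ![x, x'] b))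
      (fun (g : ℕ × EuclideanSpace ℝ (Fin n) → ℝ) (b : Fin 2) => g (1, ![x, x'] b)) Q := by
    refine IsGaussianProcess.indepFun_of_covariance_eq_zero
      (X := fun (b : Fin 2) (g : ℕ × EuclideanSpace ℝ (Fin n) → ℝ) => g (0, ![x, x'] b))
      (Y := fun (b : Fin 2) (g : ℕ × EuclideanSpace ℝ (Fin n) → ℝ) => g (1, ![x, x'] b)) ?_
      (fun b => (measurable_pi_apply _).aemeasurable)
      (fun b => (measurable_pi_apply _).aemeasurable) fun b b' => ?_
    · have h := hQ.isGaussianProcess.comp_right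
        (Sum.elim (fun b : Fin 2 => (0, ![x, x'] b)) fun b : Fin 2 => (1, ![x, x'] b))
      refine (show Sum.elim _ _ = _ from ?_) ▸ h
      ext (b | b) <;> rfl
    · rw [hQ.covariance_eq]
      simp
  have hG2' : Measurable fun z : Fin 2 → ℝ => G (z 0) (z 1) :=
    hG.comp (f := fun z : Fin 2 → ℝ => (z 0, z 1)) (by fun_prop)
  have h := (hind.comp hG2' hG2').integral_fun_mul_eq_mul_integral
    (hG2'.comp (by fun_prop)).aestronglyMeasurable (hG2'.comp (by fun_prop)).aestronglyMeasurable
  simp only [Function.comp, Matrix.cons_val_zero, Matrix.cons_val_one] at h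
  rw [h, hid, sq]

/-- Averages over the neurons of a layer of a bounded function of their pre-activations obey a law
of large numbers. -/
theorem tendstoInMeasure_average_bounded (hφ : ∀ x, Measurable (φ x)) (ha : Measurable a)
    (hQ : IsCentredGP Q (neuronKernel S))
    (hK : ∀ x x', TendstoInMeasure (initLaw n k ν)
      (fun t θ => empiricalCK φ a (d t) θ l x x') atTop fun _ => S x x')
    (x x' : EuclideanSpace ℝ (Fin n)) {G : ℝ → ℝ → ℝ} (hG : Continuous (Function.uncurry G))
    {M : ℝ} (hM : ∀ z z', |G z z'| ≤ M) {N : ℕ → ℕ} (hN : Tendsto N atTop atTop) :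
    TendstoInMeasure (initLaw n k ν) (fun t θ => 1 / (N t : ℝ) * ∑ j ∈ Finset.range (N t),
      G (preact φ a (d t) θ l j x) (preact φ a (d t) θ l j x')) atTop
      fun _ => ∫ g, G (g (0, x)) (g (0, x')) ∂Q := by
  have hm := fun t j x => measurable_preact hφ ha (d t) l j x
  have hG2 : Continuous fun z : EuclideanSpace ℝ (Fin 2) => G (z 0) (z 1) :=
    hG.comp (f := fun z : EuclideanSpace ℝ (Fin 2) => (z 0, z 1)) (by fun_prop)
  have hG4 : Continuous fun z : EuclideanSpace ℝ (Fin 2 × Fin 2) =>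
      G (z (0, 0)) (z (0, 1)) * G (z (1, 0)) (z (1, 1)) :=
    (hG.comp (f := fun z : EuclideanSpace ℝ (Fin 2 × Fin 2) => (z (0, 0), z (0, 1)))
      (by fun_prop)).mul
    (hG.comp (f := fun z : EuclideanSpace ℝ (Fin 2 × Fin 2) => (z (1, 0), z (1, 1))) (by fun_prop))
  have hM4 (z : EuclideanSpace ℝ (Fin 2 × Fin 2)) :
      |G (z (0, 0)) (z (0, 1)) * G (z (1, 0)) (z (1, 1))| ≤ M * M := by
    rw [abs_mul]
    exact mul_le_mul (hM _ _) (hM _ _) (abs_nonneg _) ((abs_nonneg _).trans (hM 0 0))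
  -- By exchangeability of the neurons, all means are that of neuron `0` and all mixed moments are
  -- that of the neurons `0` and `1`.
  refine tendstoInMeasure_average_of_array
    (p := fun t => ∫ θ, G (preact φ a (d t) θ l 0 x) (preact φ a (d t) θ l 0 x') ∂initLaw n k ν)
    (q := fun t => ∫ θ, G (preact φ a (d t) θ l 0 x) (preact φ a (d t) θ l 0 x') *
      G (preact φ a (d t) θ l 1 x) (preact φ a (d t) θ l 1 x') ∂initLaw n k ν)
    (fun t j => hG.measurable.comp ((hm t j x).prodMk (hm t j x'))) (fun t j θ => hM _ _)
    (fun t j => ?_) (fun t i j hij => ?_) ?_ ?_ hN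
  · have h := integral_preact_congr ν hφ ha (d t) l (s := fun b => (j, ![x, x'] b))
      (s' := fun b => (0, ![x, x'] b)) (by simp) (by simp) hG2
    simpa using h
  · have h := integral_preact_congr ν hφ ha (d t) l
      (s := fun b : Fin 2 × Fin 2 => (![i, j] b.1, ![x, x'] b.2))
      (s' := fun b => (![0, 1] b.1, ![x, x'] b.2)) (by simp [Fin.forall_fin_two, hij, hij.symm])
      (by simp) hG4
    simpa using h
  · have h := tendsto_integral_preact ν (tendstoInDistribution_preact ν hφ ha hQ hK
      fun b : Fin 2 => (0, ![x, x'] b)) hG2 fun z => hM _ _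
    simpa using h
  · have h := tendsto_integral_preact ν (tendstoInDistribution_preact ν hφ ha hQ hK
      fun b : Fin 2 × Fin 2 => (![0, 1] b.1, ![x, x'] b.2)) hG4 hM4
    rw [← hQ.integral_mul_neurons x x' hG.measurable]
    simpa using h

end Limit

end LayerLimit

/-! ### Square-integrable functions and truncation -/

section Kernels

theorem L2_inner_toLp {Ω E : Type*} [MeasurableSpace Ω] {μ : Measure Ω} [NormedAddCommGroup E]
    [InnerProductSpace ℝ E] {f g : Ω → E} (hf : MemLp f 2 μ) (hg : MemLp g 2 μ) :
    inner ℝ (hf.toLp f) (hg.toLp g) = ∫ w, inner ℝ (f w) (g w) ∂μ := by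
  rw [L2.inner_def]
  refine integral_congr_ae ?_
  filter_upwards [hf.coeFn_toLp, hg.coeFn_toLp] with w h h'
  rw [h, h']

theorem integrable_inner_of_memLp {Ω E : Type*} [MeasurableSpace Ω] {μ : Measure Ω}
    [NormedAddCommGroup E] [InnerProductSpace ℝ E] {f g : Ω → E} (hf : MemLp f 2 μ)
    (hg : MemLp g 2 μ) : Integrable (fun w => inner ℝ (f w) (g w)) μ := by
  refine (L2.integrable_inner (𝕜 := ℝ) (hf.toLp f) (hg.toLp g)).congr ?_
  filter_upwards [hf.coeFn_toLp, hg.coeFn_toLp] with w h h'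
  rw [h, h']

/-- The error of truncating a product at `±M` is controlled by the parts of the squares of the
factors above `M`. -/
theorem abs_mul_sub_clamp_le (A B : ℝ) {M : ℝ} (hM : 0 ≤ M) :
    |A * B - max (-M) (min M (A * B))| ≤
      (if M < A ^ 2 then A ^ 2 else 0) + (if M < B ^ 2 then B ^ 2 else 0) := by
  have hA : 0 ≤ if M < A ^ 2 then A ^ 2 else 0 := by split_ifs <;> positivity
  have hB : 0 ≤ if M < B ^ 2 then B ^ 2 else 0 := by split_ifs <;> positivity
  rcases le_or_gt |A * B| M with h | h
  · obtain ⟨h1, h2⟩ := abs_le.1 h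
    rw [min_eq_right h2, max_eq_right h1, sub_self, abs_zero]
    positivity
  have h1 : |A * B - max (-M) (min M (A * B))| ≤ |A * B| := by
    rcases lt_abs.1 h with h' | h'
    · rw [min_eq_left h'.le, max_eq_right (by linarith), abs_of_nonneg (by linarith),
        abs_of_nonneg (by linarith)]
      linarith
    · rw [min_eq_right (by linarith), max_eq_left (by linarith), abs_of_nonpos (by linarith),
        abs_of_nonpos (by linarith)]
      linarith
  have hAB : |A * B| ≤ (A ^ 2 + B ^ 2) / 2 := by
    rw [abs_mul, ← sq_abs A, ← sq_abs B]
    nlinarith [sq_nonneg (|A| - |B|)]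
  refine h1.trans ?_
  -- `M < |A B|` is at most the larger one of the squares, which therefore survives on the right.
  rcases le_total (A ^ 2) (B ^ 2) with h2 | h2
  · rw [if_pos (show M < B ^ 2 by linarith)]
    linarith
  · rw [if_pos (show M < A ^ 2 by linarith)]
    linarith

theorem continuous_clamp_mul {a : ℝ → ℝ} (ha : Continuous a) (M : ℝ) :
    Continuous (Function.uncurry fun z z' => max (-M) (min M (a z * a z'))) := by
  unfold Function.uncurry
  fun_prop

theorem abs_clamp_le {M : ℝ} (hM : 0 ≤ M) (r : ℝ) : |max (-M) (min M r)| ≤ M := by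
  rw [abs_le]
  exact ⟨le_max_left _ _, max_le (by linarith) (min_le_left _ _)⟩

theorem clamp_eq_self {M r : ℝ} (h : |r| ≤ M) : max (-M) (min M r) = r := by
  obtain ⟨h1, h2⟩ := abs_le.1 h
  rw [min_eq_right h2, max_eq_right h1]

/-- The part of a square-integrable function at large values is small in mean square. -/
theorem tendsto_lintegral_tail {Ω : Type*} [MeasurableSpace Ω] {μ : Measure Ω} {f : Ω → ℝ}
    (hf : Measurable f) (hf2 : MemLp f 2 μ) :
    Tendsto (fun M : ℕ => ∫⁻ z, ENNReal.ofReal (if (M : ℝ) < f z ^ 2 then f z ^ 2 else 0) ∂μ)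
      atTop (𝓝 0) := by
  have h := tendsto_lintegral_of_dominated_convergence (μ := μ)
    (F := fun (M : ℕ) z => ENNReal.ofReal (if (M : ℝ) < f z ^ 2 then f z ^ 2 else 0))
    (f := fun _ => 0) (fun z => ENNReal.ofReal (f z ^ 2)) (fun M => ?_)
    (fun M => ae_of_all _ fun z => ?_) hf2.integrable_sq.lintegral_lt_top.ne
    (ae_of_all _ fun z => ?_)
  · simpa using h
  · exact (Measurable.ite (measurableSet_lt measurable_const (hf.pow_const 2)) (hf.pow_const 2)
      measurable_const).ennreal_ofReal
  · refine ENNReal.ofReal_le_ofReal ?_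
    split_ifs
    · exact le_rfl
    · positivity
  · refine tendsto_const_nhds.congr' ?_
    filter_upwards [(tendsto_natCast_atTop_atTop (R := ℝ)).eventually_ge_atTop (f z ^ 2)] with M hM
    simp [not_lt.2 hM]

/-! ### The law of large numbers for the conjugate kernel -/

variable {n k : ℕ} {P : Type*} [MeasurableSpace P]
  {φ : EuclideanSpace ℝ (Fin n) → P → EuclideanSpace ℝ (Fin k)} {a : ℝ → ℝ}
  (ν : Measure P) [IsProbabilityMeasure ν]

section Activation

variable {S : EuclideanSpace ℝ (Fin n) → EuclideanSpace ℝ (Fin n) → ℝ}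
  {Q : Measure (ℕ × EuclideanSpace ℝ (Fin n) → ℝ)}

theorem IsCentredGP.memLp_comp_eval {T : Type*} {Q : Measure (T → ℝ)} {K : T → T → ℝ}
    (hQ : IsCentredGP Q K) (ha2 : ∀ v : NNReal, MemLp a 2 (gaussianReal 0 v)) (s : T) :
    MemLp (fun g => a (g s)) 2 Q :=
  (ha2 _).comp_measurePreserving ⟨measurable_pi_apply s, hQ.map_eval s⟩

theorem IsCentredGP.integrable_mul_comp_eval {T : Type*} {Q : Measure (T → ℝ)} {K : T → T → ℝ}
    (hQ : IsCentredGP Q K) (ha2 : ∀ v : NNReal, MemLp a 2 (gaussianReal 0 v)) (s s' : T) :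
    Integrable (fun g => a (g s) * a (g s')) Q :=
  (hQ.memLp_comp_eval ha2 s).integrable_mul (hQ.memLp_comp_eval ha2 s')

/-- Truncation of the product of two activations has a vanishing effect under the limiting law. -/
theorem IsCentredGP.tendsto_integral_clamp {T : Type*} {Q : Measure (T → ℝ)} {K : T → T → ℝ}
    (hQ : IsCentredGP Q K) (ha : Continuous a)
    (ha2 : ∀ v : NNReal, MemLp a 2 (gaussianReal 0 v)) (s s' : T) :
    Tendsto (fun M : ℕ => ∫ g, max (-(M : ℝ)) (min M (a (g s) * a (g s'))) ∂Q) atTop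
      (𝓝 (∫ g, a (g s) * a (g s') ∂Q)) := by
  have hm (s : T) : Measurable fun g : T → ℝ => a (g s) :=
    ha.measurable.comp (measurable_pi_apply s)
  refine tendsto_integral_of_dominated_convergence (fun g => |a (g s) * a (g s')|)
    (fun M => ?_) (hQ.integrable_mul_comp_eval ha2 s s').abs
    (fun M => ae_of_all _ fun g => ?_) (ae_of_all _ fun g => ?_)
  · exact (measurable_const.max (measurable_const.min ((hm s).mul (hm s')))).aestronglyMeasurable
  · have hM : (0 : ℝ) ≤ M := by positivity
    rw [Real.norm_eq_abs]
    rcases le_total |a (g s) * a (g s')| M with h | h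
    · rw [clamp_eq_self h]
    · exact (abs_clamp_le hM _).trans h
  · refine tendsto_const_nhds.congr' ?_
    filter_upwards [(tendsto_natCast_atTop_atTop (R := ℝ)).eventually_ge_atTop
      |a (g s) * a (g s')|] with M hM
    rw [clamp_eq_self hM]

variable [IsProbabilityMeasure Q] {d : ℕ → ℕ → ℕ} {l : ℕ}

/-- The law of large numbers for the conjugate kernel of the next layer. The activation is unbounded
and its square need not be integrable for the law of a pre-activation of finite width, which is a
mixture of Gaussians of unbounded variances; the products are therefore truncated on the likely
event that the conditional variances are at most `V`. -/
theorem tendstoInMeasure_average_activation (hφ : ∀ x, Measurable (φ x)) (ha : Continuous a)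
    (ha2 : ∀ v : NNReal, MemLp a 2 (gaussianReal 0 v))
    (hQ : IsCentredGP Q (neuronKernel S))
    (hK : ∀ x x', TendstoInMeasure (initLaw n k ν)
      (fun t θ => empiricalCK φ a (d t) θ l x x') atTop fun _ => S x x')
    (x x' : EuclideanSpace ℝ (Fin n)) {N : ℕ → ℕ} (hN : Tendsto N atTop atTop) :
    TendstoInMeasure (initLaw n k ν) (fun t θ => 1 / (N t : ℝ) * ∑ j ∈ Finset.range (N t),
      a (preact φ a (d t) θ l j x) * a (preact φ a (d t) θ l j x')) atTop
      fun _ => ∫ g, a (g (0, x)) * a (g (0, x')) ∂Q := by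
  have hpre := fun t j x => measurable_preact hφ ha.measurable (d t) l j x
  have hCK := fun t x x' => measurable_empiricalCK hφ ha.measurable (d t) l x x'
  refine tendstoInMeasure_of_approx fun ε hε η hη => ?_
  set V : NNReal := (max (S x x) (S x' x') + 1).toNNReal
  have hV : max (S x x) (S x' x') < V := (lt_add_one _).trans_le (Real.le_coe_toNNReal _)
  let tail : ℕ → ℝ → ENNReal := fun M z =>
    ENNReal.ofReal (if (M : ℝ) < a z ^ 2 then a z ^ 2 else 0)
  have htail (M) : Measurable (tail M) :=
    (Measurable.ite (measurableSet_lt measurable_const (ha.measurable.pow_const 2))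
      (ha.measurable.pow_const 2) measurable_const).ennreal_ofReal
  have hε' : ENNReal.ofReal ε ≠ 0 := by simpa using hε
  obtain ⟨M, hM1, hM2⟩ : ∃ M : ℕ,
      2 * (ENNReal.ofReal √V * ∫⁻ z, tail M z ∂gaussianReal 0 V) / ENNReal.ofReal ε ≤ η / 2 ∧
      |∫ g, max (-(M : ℝ)) (min M (a (g (0, x)) * a (g (0, x')))) ∂Q -
        ∫ g, a (g (0, x)) * a (g (0, x')) ∂Q| ≤ ε := by
    have h1 : Tendsto (fun M : ℕ =>
        2 * (ENNReal.ofReal √V * ∫⁻ z, tail M z ∂gaussianReal 0 V) / ENNReal.ofReal ε) atTop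
        (𝓝 0) := by
      have h := tendsto_lintegral_tail ha.measurable (ha2 V)
      have h' := ENNReal.Tendsto.div_const (ENNReal.Tendsto.const_mul (a := 2)
        (ENNReal.Tendsto.const_mul (a := ENNReal.ofReal √V) h (Or.inr ENNReal.ofReal_ne_top))
        (Or.inr ENNReal.ofNat_ne_top)) (b := ENNReal.ofReal ε) (Or.inr hε')
      simpa using h'
    have h2 := (Metric.tendsto_nhds.1 (hQ.tendsto_integral_clamp ha ha2 (0, x) (0, x'))) ε hε
    obtain ⟨M, hM1, hM2⟩ := ((ENNReal.tendsto_nhds_zero.1 h1 (η / 2)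
      (ENNReal.half_pos hη.ne')).and h2).exists
    exact ⟨M, hM1, hM2.le⟩
  have hM0 : (0 : ℝ) ≤ M := by positivity
  refine ⟨_, _, tendstoInMeasure_average_bounded ν hφ ha.measurable hQ hK x x'
    (continuous_clamp_mul ha M) (fun z z' => abs_clamp_le hM0 _) hN, hM2, ?_⟩
  have hη4 : 0 < η / 2 / 2 := ENNReal.half_pos (ENNReal.half_pos hη.ne').ne'
  filter_upwards [hN.eventually_gt_atTop 0,
    ENNReal.tendsto_nhds_zero.1 (tendsto_measure_setOf_gt_of_tendstoInMeasure (hK x x)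
      ((le_max_left _ _).trans_lt hV)) _ hη4,
    ENNReal.tendsto_nhds_zero.1 (tendsto_measure_setOf_gt_of_tendstoInMeasure (hK x' x')
      ((le_max_right _ _).trans_lt hV)) _ hη4] with t ht h1 h2
  have ht' : (0 : ℝ) < N t := by exact_mod_cast ht
  -- `R` bounds the truncation error on the event that both conditional variances are at most `V`.
  let r : EuclideanSpace ℝ (Fin n) → ℕ → Params n k P → ENNReal := fun x j θ =>
    if empiricalCK φ a (d t) θ l x x ≤ V then tail M (preact φ a (d t) θ l j x) else 0
  have hr (x j) : Measurable (r x j) :=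
    Measurable.ite (measurableSet_le (hCK t x x) measurable_const)
      ((htail M).comp (hpre t j x)) measurable_const
  let R : Params n k P → ENNReal := fun θ =>
    ENNReal.ofReal (1 / N t) * ∑ j ∈ Finset.range (N t), (r x j θ + r x' j θ)
  have hsum : Measurable fun θ => ∑ j ∈ Finset.range (N t), (r x j θ + r x' j θ) :=
    Finset.measurable_fun_sum _ fun j _ => (hr x j).add (hr x' j)
  have hR : Measurable R := hsum.const_mul _
  have hRint : ∫⁻ θ, R θ ∂initLaw n k ν ≤
      2 * (ENNReal.ofReal √V * ∫⁻ z, tail M z ∂gaussianReal 0 V) := by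
    rw [lintegral_const_mul _ hsum,
      lintegral_finsetSum (f := fun j θ => r x j θ + r x' j θ) _
        fun j _ => (hr x j).add (hr x' j)]
    calc _ ≤ ENNReal.ofReal (1 / N t) * ∑ j ∈ Finset.range (N t),
          2 * (ENNReal.ofReal √V * ∫⁻ z, tail M z ∂gaussianReal 0 V) := by
          gcongr with j hj
          rw [lintegral_add_left (hr x j), two_mul]
          exact add_le_add (lintegral_preact_le ν hφ ha.measurable (d t) l j x (htail M) V)
            (lintegral_preact_le ν hφ ha.measurable (d t) l j x' (htail M) V)
      _ = _ := by
          rw [Finset.sum_const, Finset.card_range, nsmul_eq_mul, ← mul_assoc,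
            ← ENNReal.ofReal_natCast, ← ENNReal.ofReal_mul (by positivity),
            one_div_mul_cancel ht'.ne', ENNReal.ofReal_one, one_mul]
  have hpt (θ : Params n k P) (hθ : empiricalCK φ a (d t) θ l x x ≤ V)
      (hθ' : empiricalCK φ a (d t) θ l x' x' ≤ V) :
      ENNReal.ofReal |1 / (N t : ℝ) * ∑ j ∈ Finset.range (N t),
          a (preact φ a (d t) θ l j x) * a (preact φ a (d t) θ l j x') -
        1 / (N t : ℝ) * ∑ j ∈ Finset.range (N t), max (-(M : ℝ)) (min M
          (a (preact φ a (d t) θ l j x) * a (preact φ a (d t) θ l j x')))| ≤ R θ := by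
    rw [← mul_sub, ← Finset.sum_sub_distrib, abs_mul, abs_of_nonneg (by positivity),
      ENNReal.ofReal_mul (by positivity)]
    simp only [R]
    gcongr
    refine (ENNReal.ofReal_le_ofReal (Finset.abs_sum_le_sum_abs _ _)).trans ?_
    rw [ENNReal.ofReal_sum_of_nonneg fun j _ => abs_nonneg _]
    refine Finset.sum_le_sum fun j _ => ?_
    refine (ENNReal.ofReal_le_ofReal (abs_mul_sub_clamp_le _ _ hM0)).trans ?_
    simp only [r, if_pos hθ, if_pos hθ', tail]
    exact ENNReal.ofReal_add_le
  calc _ ≤ initLaw n k ν ({θ | V < empiricalCK φ a (d t) θ l x x} ∪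
        {θ | V < empiricalCK φ a (d t) θ l x' x'} ∪ {θ | ENNReal.ofReal ε ≤ R θ}) := by
        refine measure_mono fun θ hθ => ?_
        by_contra hcon
        simp only [Set.mem_union, Set.mem_ofPred_eq, not_or, not_lt, not_le] at hcon
        obtain ⟨⟨hc1, hc2⟩, hc3⟩ := hcon
        exact absurd ((ENNReal.ofReal_le_ofReal hθ).trans (hpt θ hc1 hc2)) (not_le.2 hc3)
    _ ≤ η / 2 / 2 + η / 2 / 2 + η / 2 := by
        refine (measure_union_le _ _).trans (add_le_add ((measure_union_le _ _).trans
          (add_le_add h1 h2)) ?_)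
        refine (meas_ge_le_lintegral_div hR.aemeasurable hε' ENNReal.ofReal_ne_top).trans ?_
        exact (ENNReal.div_le_div_right hRint _).trans hM1
    _ = η := by rw [ENNReal.add_halves, ENNReal.add_halves]

end Activation

/-! ### The feature mapping layer -/

/-- The conjugate kernel of the feature mapping layer obeys the law of large numbers. -/
theorem tendstoInMeasure_empiricalCK_one (hφ : ∀ x, Measurable (φ x))
    (hφ2 : ∀ x, MemLp (φ x) 2 ν) {d : ℕ → ℕ → ℕ} (hd : Tendsto (fun t => d t 1) atTop atTop)
    (x x' : EuclideanSpace ℝ (Fin n)) :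
    TendstoInMeasure (initLaw n k ν) (fun t θ => empiricalCK φ a (d t) θ 1 x x') atTop
      fun _ => ∫ w, inner ℝ (φ x w) (φ x' w) ∂ν + 1 := by
  have hm : Measurable fun w => inner ℝ (φ x w) (φ x' w) := (hφ x).inner (hφ x')
  have hint : Integrable (fun w => inner ℝ (φ x w) (φ x' w)) ν :=
    integrable_inner_of_memLp (hφ2 x) (hφ2 x')
  let ρ := Measure.infinitePi fun _ : ℕ => ν
  have hmp := measurePreserving_eval_infinitePi (fun _ : ℕ => ν)
  let X : ℕ → (ℕ → P) → ℝ := fun j w => inner ℝ (φ x (w j)) (φ x' (w j))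
  have hlaw (j) : ρ.map (X j) = ν.map fun w => inner ℝ (φ x w) (φ x' w) := by
    rw [← (hmp j).map_eq, Measure.map_map hm (measurable_pi_apply j)]
    rfl
  have hslln := strong_law_ae_real (μ := ρ) X ((hmp 0).integrable_comp_of_integrable hint)
    (fun i j hij => (iIndepFun_infinitePi (P := fun _ : ℕ => ν)
      (X := fun _ w => inner ℝ (φ x w) (φ x' w)) fun _ => hm).indepFun hij)
    fun j => ⟨(hm.comp (measurable_pi_apply j)).aemeasurable,
      (hm.comp (measurable_pi_apply 0)).aemeasurable, by rw [hlaw, hlaw]⟩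
  have hmean : ∫ w, X 0 w ∂ρ = ∫ w, inner ℝ (φ x w) (φ x' w) ∂ν := by
    rw [← (hmp 0).map_eq, integral_map (measurable_pi_apply 0).aemeasurable
      hm.aestronglyMeasurable]
  have hae : ∀ᵐ θ ∂initLaw n k ν, Tendsto
      (fun N : ℕ => (∑ j ∈ Finset.range N, X j θ.2) / N) atTop
      (𝓝 (∫ w, inner ℝ (φ x w) (φ x' w) ∂ν)) := by
    rw [hmean] at hslln
    exact Measure.quasiMeasurePreserving_snd.ae hslln
  refine tendstoInMeasure_of_tendsto_ae (fun t => ?_) ?_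
  · have : Measurable fun θ : Params n k P => ∑ j ∈ Finset.range (d t 1), X j θ.2 :=
      Finset.measurable_fun_sum _ fun j _ => hm.comp (by fun_prop)
    exact ((this.const_mul _).add_const 1).aestronglyMeasurable
  · filter_upwards [hae] with θ hθ
    have := (hθ.comp hd).add_const 1
    refine this.congr fun t => ?_
    simp [empiricalCK, X, div_eq_inv_mul]

/-! ### Limit kernels and convergence of the conjugate kernels -/

/-- The limit of the conjugate kernels, defined by recursion on the layer. -/
noncomputable def limitKernel (φ : EuclideanSpace ℝ (Fin n) → P → EuclideanSpace ℝ (Fin k))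
    (a : ℝ → ℝ) : ℕ → EuclideanSpace ℝ (Fin n) → EuclideanSpace ℝ (Fin n) → ℝ
  | 0, x, x' => inner ℝ x x' + 1
  | 1, x, x' => ∫ w, inner ℝ (φ x w) (φ x' w) ∂ν + 1
  | l + 2, x, x' => ∫ z, a (z 0) * a (z 1) ∂pairGaussian (limitKernel φ a (l + 1)) x x' + 1

theorem pairGaussian_neuronKernel {T : Type*} (S : T → T → ℝ) (x x' : T) :
    pairGaussian (neuronKernel S) (0, x) (0, x') = pairGaussian S x x' := by
  simp [pairGaussian, neuronKernel]

section PairGaussian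

variable {T : Type*} {S : T → T → ℝ} {Q : Measure (ℕ × T → ℝ)} [IsProbabilityMeasure Q]

theorem continuous_mul_apply_fin_two (ha : Continuous a) :
    Continuous fun z : EuclideanSpace ℝ (Fin 2) => a (z 0) * a (z 1) := by
  fun_prop

theorem IsCentredGP.integral_pairGaussian (hQ : IsCentredGP Q (neuronKernel S)) (ha : Continuous a)
    (x x' : T) : ∫ z, a (z 0) * a (z 1) ∂pairGaussian S x x' =
      ∫ g, a (g (0, x)) * a (g (0, x')) ∂Q := by
  rw [← pairGaussian_neuronKernel, hQ.pairGaussian_eq, integral_map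
    (Measurable.aemeasurable (by fun_prop)) (continuous_mul_apply_fin_two ha).aestronglyMeasurable]
  simp

theorem IsCentredGP.integrable_pairGaussian (hQ : IsCentredGP Q (neuronKernel S))
    (ha : Continuous a) (ha2 : ∀ v : NNReal, MemLp a 2 (gaussianReal 0 v)) (x x' : T) :
    Integrable (fun z => a (z 0) * a (z 1)) (pairGaussian S x x') := by
  rw [← pairGaussian_neuronKernel, hQ.pairGaussian_eq, integrable_map_measure
    (continuous_mul_apply_fin_two ha).aestronglyMeasurable (Measurable.aemeasurable (by fun_prop))]
  simpa [Function.comp_def] using hQ.integrable_mul_comp_eval ha2 (0, x) (0, x')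

end PairGaussian

omit [IsProbabilityMeasure ν] in
/-- The limit kernels are covariances of Gaussian processes: each is `1` plus the Gram kernel of the
inputs of the limiting layer, seen as vectors of an `L²` space. -/
theorem exists_isCentredGP_limitKernel (hφ : ∀ x, MemLp (φ x) 2 ν) (ha : Continuous a)
    (ha2 : ∀ v : NNReal, MemLp a 2 (gaussianReal 0 v)) :
    ∀ l, ∃ (Q : Measure (ℕ × EuclideanSpace ℝ (Fin n) → ℝ)) (_ : IsProbabilityMeasure Q),
      IsCentredGP Q (neuronKernel (limitKernel ν φ a l))
  | 0 => exists_isCentredGP_neurons fun x : EuclideanSpace ℝ (Fin n) => x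
  | 1 => by
    have h := exists_isCentredGP_neurons fun x => (hφ x).toLp
    simp only [L2_inner_toLp] at h
    exact h
  | l + 2 => by
    obtain ⟨Q, _, hQ⟩ := exists_isCentredGP_limitKernel hφ ha ha2 (l + 1)
    have h := exists_isCentredGP_neurons fun x => (hQ.memLp_comp_eval ha2 (0, x)).toLp
    have hS (x x') : limitKernel ν φ a (l + 2) x x' =
        inner ℝ ((hQ.memLp_comp_eval ha2 (0, x)).toLp) ((hQ.memLp_comp_eval ha2 (0, x')).toLp)
          + 1 := by
      rw [limitKernel, hQ.integral_pairGaussian ha, L2_inner_toLp]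
      simp [mul_comm]
    simp only [← hS] at h
    exact h

/-- Convergence of the conjugate kernels, by induction on the layer. -/
theorem tendstoInMeasure_empiricalCK (hφ : ∀ x, Measurable (φ x)) (hφ2 : ∀ x, MemLp (φ x) 2 ν)
    (ha : Continuous a) (ha2 : ∀ v : NNReal, MemLp a 2 (gaussianReal 0 v)) {d : ℕ → ℕ → ℕ} :
    ∀ l, (∀ j, 1 ≤ j → j ≤ l → Tendsto (fun t => d t j) atTop atTop) → ∀ x x',
      TendstoInMeasure (initLaw n k ν) (fun t θ => empiricalCK φ a (d t) θ l x x') atTop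
        fun _ => limitKernel ν φ a l x x'
  | 0, _, x, x' => fun ε hε => by simp [empiricalCK, limitKernel, hε.not_ge]
  | 1, hd, x, x' => tendstoInMeasure_empiricalCK_one ν hφ hφ2 (hd 1 le_rfl le_rfl) x x'
  | l + 2, hd, x, x' => by
    obtain ⟨Q, _, hQ⟩ := exists_isCentredGP_limitKernel ν hφ2 ha ha2 (l + 1)
    have ih := tendstoInMeasure_empiricalCK hφ hφ2 ha ha2 (l + 1)
      fun j h1 h2 => hd j h1 (h2.trans (Nat.le_succ _))
    have h := tendstoInMeasure_average_activation ν hφ ha ha2 hQ ih x x'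
      (hd (l + 2) (by lia) le_rfl)
    simp only [empiricalCK, limitKernel, hQ.integral_pairGaussian ha]
    exact tendstoInMeasure_comp_of_continuousAt (ι := Unit) (X := fun _ => _) (c := fun _ => _)
      (fun _ => h) (g := fun c => c () + 1) (Continuous.continuousAt (by fun_prop))

/-! ### Almost everywhere equal feature mappings -/

omit [IsProbabilityMeasure ν] in
theorem limitKernel_congr {φ' : EuclideanSpace ℝ (Fin n) → P → EuclideanSpace ℝ (Fin k)}
    (h : ∀ x, φ x =ᵐ[ν] φ' x) : ∀ l, limitKernel ν φ a l = limitKernel ν φ' a l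
  | 0 => rfl
  | 1 => by
    ext x x'
    simp only [limitKernel]
    congr 1
    refine integral_congr_ae ?_
    filter_upwards [h x, h x'] with w h1 h2
    rw [h1, h2]
  | l + 2 => by
    ext x x'
    simp only [limitKernel, limitKernel_congr h (l + 1)]

/-- Almost surely, two feature mappings which agree `ν`-almost everywhere agree at all sampled
feature parameters. -/
theorem ae_feature_eq {φ' : EuclideanSpace ℝ (Fin n) → P → EuclideanSpace ℝ (Fin k)}
    (h : ∀ x, φ x =ᵐ[ν] φ' x) (x : EuclideanSpace ℝ (Fin n)) :
    ∀ᵐ θ ∂initLaw n k ν, ∀ j, φ x (θ.2 j) = φ' x (θ.2 j) := by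
  refine ae_all_iff.2 fun j => ?_
  have h1 := (measurePreserving_eval_infinitePi (fun _ : ℕ => ν) j).quasiMeasurePreserving.ae (h x)
  exact Measure.quasiMeasurePreserving_snd.ae h1

omit [MeasurableSpace P] in
theorem preact_congr {φ' : EuclideanSpace ℝ (Fin n) → P → EuclideanSpace ℝ (Fin k)} {d : ℕ → ℕ}
    {θ : Params n k P} {x : EuclideanSpace ℝ (Fin n)} (h : ∀ j, φ x (θ.2 j) = φ' x (θ.2 j)) :
    ∀ l i, preact φ a d θ l i x = preact φ' a d θ l i x
  | 0, i => rfl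
  | 1, i => by simp only [preact, h]
  | l + 2, i => by simp only [preact, preact_congr h (l + 1)]

omit [MeasurableSpace P] in
theorem empiricalCK_congr {φ' : EuclideanSpace ℝ (Fin n) → P → EuclideanSpace ℝ (Fin k)}
    {d : ℕ → ℕ} {θ : Params n k P} {x x' : EuclideanSpace ℝ (Fin n)}
    (h : ∀ j, φ x (θ.2 j) = φ' x (θ.2 j)) (h' : ∀ j, φ x' (θ.2 j) = φ' x' (θ.2 j)) :
    ∀ l, empiricalCK φ a d θ l x x' = empiricalCK φ' a d θ l x x'
  | 0 => rfl
  | 1 => by simp only [empiricalCK, h, h']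
  | l + 2 => by simp only [empiricalCK, preact_congr h, preact_congr h']

end Kernels

end WideMLP

theorem theorem3p1 {n k : ℕ} {P : Type*} [MeasurableSpace P]
    (ν : Measure P) [IsProbabilityMeasure ν]
    (φ : EuclideanSpace ℝ (Fin n) → P → EuclideanSpace ℝ (Fin k))
    (hφ : ∀ x, MemLp (φ x) 2 ν)
    (a : ℝ → ℝ) (ha : Continuous a) (ha2 : ∀ v : NNReal, MemLp a 2 (gaussianReal 0 v))
    (L : ℕ) :
    ∃ S : ℕ → EuclideanSpace ℝ (Fin n) → EuclideanSpace ℝ (Fin n) → ℝ,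
      -- the recursion
      (∀ x x', S 0 x x' = inner ℝ x x' + 1) ∧
      (∀ x x', Integrable (fun ω => inner ℝ (φ x ω) (φ x' ω)) ν ∧
        S 1 x x' = (∫ ω, inner ℝ (φ x ω) (φ x' ω) ∂ν) + 1) ∧
      (∀ l, 2 ≤ l → l ≤ L → ∀ x x',
        Integrable (fun z => a (z 0) * a (z 1)) (WideMLP.pairGaussian (S (l - 1)) x x') ∧
        S l x x' = (∫ z, a (z 0) * a (z 1) ∂(WideMLP.pairGaussian (S (l - 1)) x x')) + 1) ∧
      -- the infinite-width limit, along any sequence `d t` of widths that all tend to infinity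
      ∀ d : ℕ → ℕ → ℕ, (∀ l, 1 ≤ l → l ≤ L → Tendsto (fun t => d t l) atTop atTop) →
        ∀ l ≤ L,
          -- the neurons of layer `l` tend to independent Gaussian processes `GP(0, S l)`
          WideMLP.TendstoGP (WideMLP.initLaw n k ν)
            (fun t (s : ℕ × EuclideanSpace ℝ (Fin n)) θ =>
              WideMLP.preact φ a (d t) θ l s.1 s.2)
            (fun s s' => if s.1 = s'.1 then S l s.2 s'.2 else 0) ∧
          -- the conjugate kernel of layer `l` tends to `S l` in probability
          ∀ x x', TendstoInMeasure (WideMLP.initLaw n k ν)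
            (fun t θ => WideMLP.empiricalCK φ a (d t) θ l x x') atTop (fun _ => S l x x') := by
  refine ⟨WideMLP.limitKernel ν φ a, fun _ _ => rfl,
    fun x x' => ⟨WideMLP.integrable_inner_of_memLp (hφ x) (hφ x'), rfl⟩,
    fun l hl _ x x' => ?_, fun d hd l hl => ?_⟩
  · obtain ⟨l, rfl⟩ := Nat.exists_eq_add_of_le' hl
    obtain ⟨Q, _, hQ⟩ := WideMLP.exists_isCentredGP_limitKernel ν hφ ha ha2 (l + 1)
    exact ⟨hQ.integrable_pairGaussian ha ha2 x x', rfl⟩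
  · obtain ⟨Q, _, hQ⟩ := WideMLP.exists_isCentredGP_limitKernel ν hφ ha ha2 l
    -- `φ x` is only almost everywhere measurable; the argument applies to a measurable version.
    let φ' := fun x => (hφ x).1.mk (φ x)
    have hφφ' (x) : φ x =ᵐ[ν] φ' x := (hφ x).1.ae_eq_mk
    have hφ' (x) : Measurable (φ' x) := (hφ x).1.stronglyMeasurable_mk.measurable
    have hK := WideMLP.tendstoInMeasure_empiricalCK ν hφ' (fun x => (hφ x).ae_eq (hφφ' x)) ha ha2 l
      fun j h1 h2 => hd j h1 (h2.trans hl)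
    rw [← WideMLP.limitKernel_congr ν hφφ' l] at hK
    refine ⟨⟨Q, inferInstance, hQ, fun I => ?_⟩, fun x x' => ?_⟩
    · have h := (WideMLP.tendstoInDistribution_preact ν hφ' ha.measurable hQ hK
        (fun s : I => s.1)).continuous_comp (g := WithLp.ofLp) (by fun_prop)
      refine TendstoInDistribution.congr (fun t => ?_) ae_eq_rfl h
      have hae : ∀ᵐ θ ∂WideMLP.initLaw n k ν, ∀ s : I, ∀ j,
          φ s.1.2 (θ.2 j) = φ' s.1.2 (θ.2 j) :=
        ae_all_iff.2 fun s => WideMLP.ae_feature_eq ν hφφ' s.1.2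
      filter_upwards [hae] with θ hθ
      ext s
      exact (WideMLP.preact_congr (hθ s) l s.1.1).symm
    · refine (hK x x').congr_left fun t => ?_
      filter_upwards [WideMLP.ae_feature_eq ν hφφ' x, WideMLP.ae_feature_eq ν hφφ' x']
        with θ h1 h2
      exact (WideMLP.empiricalCK_congr h1 h2 l).symm
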